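/- Let $n\ge 1$ and $0<p<1$. A polytope in $\mathbb{R}^n$ is the convex hull of a finite set of points that has positive $n$-dimensional volume. For a polytope $P$ that contains the origin in its interior, the $L_p$ surface area measure $S_p(P,\cdot)$ is the Borel measure on the unit sphere $S^{n-1}$ given by $$S_p(P,\omega)=\int_{\nu_P^{-1}(\omega)}(x\cdot\nu_P(x))^{1-p}\,d\mathcal{H}^{n-1}(x)\qquad(\omega\subseteq S^{n-1}\text{ Borel}),$$ where $\mathcal{H}^{n-1}$ is $(n-1)$-dimensional Hausdorff measure (normalized to agree with Lebesgue measure on $(n-1)$-dimensional subspaces) and $\nu_P$ is the Gauss map, which sends each boundary point of $P$ that has a unique outer unit normal to that normal. A discrete measure on $S^{n-1}$ is a finite sum $\mu=\sum_{k}\alpha_k\delta_{u_k}$ of point masses with $\alpha_k>0$ and $u_k\in S^{n-1}$; a closed hemisphere is a set $\{u\in S^{n-1}:u\cdot v\ge 0\}$ with $v\in S^{n-1}$. 1. Let $\mu$ be a discrete measure on $S^{n-1}$. There is a polytope $P$ in $\mathbb{R}^n$ that contains the origin in its interior and satisfies $\mu=S_p(P,\cdot)$ if and only if the support of $\mu$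 is not contained in a closed hemisphere. 2. In particular, if $N\ge n+1$, $\alpha_1,\dots,\alpha_N>0$, and the unit vectors $u_1,\dots,u_N\in S^{n-1}$ are not contained in a closed hemisphere, then there is a polytope $P_0$ that contains the origin in its interior and satisfies $S_p(P_0,\cdot)=\sum_{k=1}^N\alpha_k\delta_{u_k}$. -/

import Mathlib

open MeasureTheory
open scoped ENNReal

namespace LpMinkowski

/-- A polytope in `ℝⁿ`: the convex hull of a finite set of points, with positive volume. -/
def IsPolytope {n : ℕ} (P : Set (EuclideanSpace ℝ (Fin n))) : Prop :=
  (∃ s : Finset (EuclideanSpace ℝ (Fin n)), P = convexHull ℝ (s : Set (EuclideanSpace ℝ (Fin n)))) ∧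
    0 < volume P

/-- `v` is an outer unit normal of `K` at `x`: it is a unit vector and `K` lies in the half-space
`{y | y · v ≤ x · v}`. -/
def IsOuterUnitNormal {n : ℕ} (K : Set (EuclideanSpace ℝ (Fin n)))
    (x v : EuclideanSpace ℝ (Fin n)) : Prop :=
  ‖v‖ = 1 ∧ ∀ y ∈ K, inner ℝ y v ≤ inner ℝ x v

/-- `∂'K`, the set of boundary points of `K` that have a unique outer unit normal. -/
def regularBoundary {n : ℕ} (K : Set (EuclideanSpace ℝ (Fin n))) :
    Set (EuclideanSpace ℝ (Fin n)) :=
  {x | x ∈ frontier K ∧ ∃! v, IsOuterUnitNormal K x v}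

/-- The Gauss map of `K`: on `∂'K` its value is the unique outer unit normal. Its values outside
`∂'K` are arbitrary and never used. -/
noncomputable def gaussMap {n : ℕ} (K : Set (EuclideanSpace ℝ (Fin n)))
    (x : EuclideanSpace ℝ (Fin n)) : EuclideanSpace ℝ (Fin n) :=
  Classical.epsilon (IsOuterUnitNormal K x)

/-- The inverse image of `ω ⊆ Sⁿ⁻¹` under the Gauss map, as a subset of `∂'K`. -/
def gaussPreimage {n : ℕ} (K : Set (EuclideanSpace ℝ (Fin n)))
    (ω : Set (Metric.sphere (0 : EuclideanSpace ℝ (Fin n)) 1)) :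
    Set (EuclideanSpace ℝ (Fin n)) :=
  {x | x ∈ regularBoundary K ∧ ∃ u ∈ ω, (u : EuclideanSpace ℝ (Fin n)) = gaussMap K x}

/-- The value `S_p(K, ω)`, that is, the integral over the inverse image of `ω` under the Gauss map
of `(x · ν_K(x)) ^ (1 - p)` with respect to `(n-1)`-dimensional Hausdorff measure (normalized so
that it is Lebesgue measure on `(n-1)`-dimensional subspaces). It is used for convex bodies `K` that
contain the origin in the interior, where `x · ν_K(x) > 0`. -/
noncomputable def lpSurfaceArea {n : ℕ} (p : ℝ) (K : Set (EuclideanSpace ℝ (Fin n)))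
    (ω : Set (Metric.sphere (0 : EuclideanSpace ℝ (Fin n)) 1)) : ℝ≥0∞ :=
  ∫⁻ x in gaussPreimage K ω, ENNReal.ofReal ((inner ℝ x (gaussMap K x) : ℝ) ^ (1 - p))
    ∂(Measure.euclideanHausdorffMeasure (n - 1))

/-- The Borel measure `μ` on the sphere is the `L_p` surface area measure `S_p(K, ·)`: the two agree
on every Borel set. -/
def IsLpSurfaceAreaMeasure {n : ℕ} (p : ℝ) (K : Set (EuclideanSpace ℝ (Fin n)))
    (μ : Measure (Metric.sphere (0 : EuclideanSpace ℝ (Fin n)) 1)) : Prop :=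
  ∀ ω : Set (Metric.sphere (0 : EuclideanSpace ℝ (Fin n)) 1),
    MeasurableSet ω → μ ω = lpSurfaceArea p K ω

/-- A discrete measure on the sphere: a finite sum of positive point masses. -/
def IsDiscreteMeasure {n : ℕ}
    (μ : Measure (Metric.sphere (0 : EuclideanSpace ℝ (Fin n)) 1)) : Prop :=
  ∃ (s : Finset (Metric.sphere (0 : EuclideanSpace ℝ (Fin n)) 1))
    (α : Metric.sphere (0 : EuclideanSpace ℝ (Fin n)) 1 → ℝ),
    (∀ u ∈ s, 0 < α u) ∧ μ = ∑ u ∈ s, ENNReal.ofReal (α u) • Measure.dirac u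

/-- The closed hemisphere `{u ∈ Sⁿ⁻¹ | u · v ≥ 0}` with centre `v ∈ Sⁿ⁻¹`. -/
def closedHemisphere {n : ℕ} (v : Metric.sphere (0 : EuclideanSpace ℝ (Fin n)) 1) :
    Set (Metric.sphere (0 : EuclideanSpace ℝ (Fin n)) 1) :=
  {u | 0 ≤ (inner ℝ (u : EuclideanSpace ℝ (Fin n)) (v : EuclideanSpace ℝ (Fin n)) : ℝ)}

/-- The set `A` of unit vectors is contained in some closed hemisphere. -/
def ConcentratedOnClosedHemisphere {n : ℕ}
    (A : Set (Metric.sphere (0 : EuclideanSpace ℝ (Fin n)) 1)) : Prop :=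
  ∃ v, A ⊆ closedHemisphere v

end LpMinkowski

/-!
# The discrete `L_p` Minkowski problem for `0 < p < 1`

**Necessity.** Let `P` be a polytope with the origin in its interior and let `v` be a unit vector.
Rays in directions close to `-v` leave `P` through faces whose outer normals `w` satisfy
`w · v < 0`. There are finitely many faces and their cones cover a ball, so the cone over one of
them has positive volume. The cone over the intersection of two faces with different normals lies in a
hyperplane through the origin, so after removing such intersections the face still has positive
area, and it consists of points with the unique normal `w`
(`exists_regular_subset_of_normal_neg`). Hence `S_p(P, ·)` charges the open hemisphere opposite
to `v`.

**Sufficiency.** For unit vectors `u k` let `wulff u h = {x | x · u k ≤ h k for all k}` and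
`F h = ∑ α k * h k ^ p`. The translates of `wulff u h` have heights `h k - ξ · u k`, and the value
of interest is the maximum of `F (h - ξ · u)` over the points `ξ` of `wulff u h`. This value has a
minimizer among the `h` of volume at least one, normalized so that the maximum is attained at
`ξ = 0`; that normalization is a closed condition on which `F` is coercive
(`exists_isMinOn_powerSum_centeredHeights`). Since `p < 1`, the slope of `t ↦ t ^ p` is infinite
at `0`, which forces `h > 0` (`pos_of_mem_centeredHeights`), and then maximality at `ξ = 0` gives
`∑ L k • u k = 0` for `L k = α k * h k ^ (p - 1)`. As `F` is concave, it lies below its tangent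
functional at `h`, and that functional is invariant under translations. So `h` also minimizes the
*linear* functional `∑ L k * g k` among all `g` of volume at least one
(`exists_forall_sum_mul_le`).

This is the variational problem of the classical Minkowski problem, and its first-order condition
gives the facet areas. Comparing `h` with `h k` lowered to `(1 - t) * h k` shows that the cone over
the `k`-th facet has volume at least `L k * h k / ∑ j, L j * h j` (`le_volume_sector`). These cones
are disjoint and the total volume is one, so equality holds. The cone-volume formula
`volume_truncatedCone` turns this into the area of the facet, which is proportional to
`α k * h k ^ (p - 1)`; a dilation adjusts the constant, because areas weighted by `h ^ (1 - p)`
scale with the exponent `n - p ≠ 0`.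
-/

namespace LpMinkowski

/-! ### Cones over pieces of hyperplanes -/

section Cone

variable {E : Type*} [NormedAddCommGroup E] [InnerProductSpace ℝ E]

/-- The truncated cone with apex `0` over `A`, without its apex: all `ρ • x` with `0 < ρ ≤ 1` and
`x ∈ A`. -/
def truncatedCone (A : Set E) : Set E :=
  {y | ∃ ρ : ℝ, 0 < ρ ∧ ρ ≤ 1 ∧ ∃ x ∈ A, y = ρ • x}

theorem mem_truncatedCone_iff {A : Set E} {w : E} {c : ℝ} (hc : 0 < c)
    (hA : ∀ x ∈ A, inner ℝ x w = c) (y : E) :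
    y ∈ truncatedCone A ↔
      0 < inner ℝ y w ∧ inner ℝ y w ≤ c ∧ (c / inner ℝ y w) • y ∈ A := by
  constructor
  · rintro ⟨ρ, h0, h1, x, hx, rfl⟩
    have : c / (ρ * c) * ρ = 1 := by field_simp
    rw [inner_smul_left, hA x hx, smul_smul]
    simp only [conj_trivial]
    rw [this, one_smul]
    exact ⟨by positivity, by nlinarith, hx⟩
  · rintro ⟨h0, h1, hx⟩
    refine ⟨inner ℝ y w / c, by positivity, (div_le_one hc).2 h1, _, hx, ?_⟩
    rw [smul_smul, show inner ℝ y w / c * (c / inner ℝ y w) = 1 by field_simp, one_smul]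

theorem truncatedCone_inter_slice {A : Set E} {w : E} {c : ℝ} (hw : ‖w‖ = 1) (hc : 0 < c)
    (hA : ∀ x ∈ A, inner ℝ x w = c) (t : ℝ) :
    truncatedCone A ∩ (AffineSubspace.mk' (t • w +ᵥ (0 : E)) (Submodule.span ℝ {w})ᗮ : Set E) =
      if t ∈ Set.Ioc 0 c then (fun x => (t / c) • x) '' A else ∅ := by
  have hmem : ∀ y, y ∈ (AffineSubspace.mk' (t • w +ᵥ (0 : E)) (Submodule.span ℝ {w})ᗮ : Set E) ↔
      inner ℝ y w = t := by
    intro y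
    simp only [SetLike.mem_coe, AffineSubspace.mem_mk',
      Submodule.mem_orthogonal_singleton_iff_inner_left, vsub_eq_sub, vadd_eq_add, add_zero,
      inner_sub_left, inner_smul_left,
      real_inner_self_eq_norm_sq, hw]
    simp [sub_eq_zero]
  ext y
  rw [Set.mem_inter_iff, hmem, mem_truncatedCone_iff hc hA]
  split_ifs with ht
  · have ht0 := ht.1
    constructor
    · rintro ⟨⟨-, -, h⟩, rfl⟩
      refine ⟨_, h, ?_⟩
      simp only [smul_smul]
      rw [show inner ℝ y w / c * (c / inner ℝ y w) = 1 by field_simp, one_smul]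
    · rintro ⟨x, hx, rfl⟩
      have h : inner ℝ ((t / c) • x) w = t := by
        rw [inner_smul_left, hA x hx]
        simp only [conj_trivial]
        field_simp
      rw [h, smul_smul, show c / t * (t / c) = 1 by field_simp, one_smul]
      exact ⟨⟨ht0, ht.2, hx⟩, rfl⟩
  · simp only [Set.mem_empty_iff_false, iff_false]
    rintro ⟨⟨h0, h1, -⟩, rfl⟩
    exact ht ⟨h0, h1⟩

variable [FiniteDimensional ℝ E] [MeasurableSpace E] [BorelSpace E]

theorem measurableSet_truncatedCone {A : Set E} (hAm : MeasurableSet A) {w : E} {c : ℝ}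
    (hc : 0 < c) (hA : ∀ x ∈ A, inner ℝ x w = c) : MeasurableSet (truncatedCone A) := by
  have h : truncatedCone A = {y | 0 < inner ℝ y w} ∩ ({y | inner ℝ y w ≤ c} ∩
      (fun y => (c / inner ℝ y w) • y) ⁻¹' A) := by
    ext y
    exact mem_truncatedCone_iff hc hA y
  have hm : Measurable fun y : E => inner ℝ y w := by fun_prop
  rw [h]
  refine (measurableSet_lt measurable_const hm).inter
    ((measurableSet_le hm measurable_const).inter ?_)
  exact ((measurable_const.div hm).smul measurable_id) hAm

theorem lintegral_Ioc_div_pow {c : ℝ} (hc : 0 < c) {n : ℕ} (hn : 1 ≤ n) :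
    ∫⁻ t in Set.Ioc 0 c, ENNReal.ofReal ((t / c) ^ (n - 1)) = ENNReal.ofReal (c / n) := by
  rw [← ofReal_integral_eq_lintegral_ofReal]
  · congr 1
    rw [← intervalIntegral.integral_of_le hc.le]
    have h : ∀ t : ℝ, (t / c) ^ (n - 1) = t ^ (n - 1) / c ^ (n - 1) := fun t => div_pow ..
    simp_rw [h]
    rw [intervalIntegral.integral_div, integral_pow]
    obtain ⟨m, rfl⟩ : ∃ m, n = m + 1 := ⟨n - 1, by omega⟩
    simp only [Nat.add_sub_cancel]
    push_cast
    field_simp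
    simp [pow_succ]
  · apply Continuous.integrableOn_Ioc
    fun_prop
  · filter_upwards [ae_restrict_mem measurableSet_Ioc] with t ht
    have := ht.1
    positivity

/-- The cone-volume formula: a cone of height `c` over a base `A` in a hyperplane has volume
`c / n` times the area of `A`. The slice at height `t` is a copy of `A` scaled by `t / c`. -/
theorem volume_truncatedCone {A : Set E} (hAm : MeasurableSet A) {w : E} {c : ℝ} (hw : ‖w‖ = 1)
    (hc : 0 < c) (hA : ∀ x ∈ A, inner ℝ x w = c) :
    volume (truncatedCone A) =
      ENNReal.ofReal (c / Module.finrank ℝ E) *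
        Measure.euclideanHausdorffMeasure (Module.finrank ℝ E - 1) A := by
  have hw0 : w ≠ 0 := by
    rintro rfl
    simp at hw
  have hn : 1 ≤ Module.finrank ℝ E := by
    have : Nontrivial E := ⟨w, 0, hw0⟩
    exact Module.finrank_pos
  have hen : ‖w‖ₑ = 1 := by
    rw [← ofReal_norm, hw, ENNReal.ofReal_one]
  rw [← InnerProductSpace.euclideanHausdorffMeasure_eq_volume,
    EuclideanGeometry.euclideanHausdorffMeasure_eq_lintegral (0 : E) hw0
      (measurableSet_truncatedCone hAm hc hA), hen, one_mul, ← lintegral_Ioc_div_pow hc hn,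
    ← lintegral_mul_const _ (by fun_prop), ← lintegral_indicator measurableSet_Ioc]
  congr with t
  rw [truncatedCone_inter_slice hw hc hA]
  split_ifs with ht
  · have ht0 : t / c ≠ 0 := (div_pos ht.1 hc).ne'
    rw [Set.indicator_of_mem ht, Set.image_smul,
      Measure.euclideanHausdorffMeasure_smul₀ _ ht0, ENNReal.smul_def, smul_eq_mul]
    congr 1
    rw [ENNReal.coe_pow, ENNReal.ofReal_pow (div_pos ht.1 hc).le]
    congr 1
    rw [ENNReal.ofReal, Real.toNNReal_of_nonneg (div_pos ht.1 hc).le]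
    congr 1
    ext
    exact abs_of_pos (div_pos ht.1 hc)
  · rw [Set.indicator_of_notMem ht, measure_empty]

/-- A linear hyperplane is a null set. -/
theorem volume_inner_eq_zero {w : E} (hw : w ≠ 0) : volume {x : E | inner ℝ x w = 0} = 0 := by
  have h : {x : E | inner ℝ x w = 0} = ((Submodule.span ℝ {w})ᗮ : Submodule ℝ E) := by
    ext x
    simp [Submodule.mem_orthogonal_singleton_iff_inner_left]
  rw [h]
  refine Measure.addHaar_submodule _ _ fun htop => hw ?_
  have : w ∈ (Submodule.span ℝ {w})ᗮ := htop ▸ Submodule.mem_top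
  rw [Submodule.mem_orthogonal_singleton_iff_inner_left] at this
  exact inner_self_eq_zero.1 this

end Cone

/-! ### Necessity: facets facing every direction -/

section Normals

variable {E : Type*} [NormedAddCommGroup E] [InnerProductSpace ℝ E]

/-- The face of `convexHull ℝ s` in a direction `w` is spanned by the points of `s` on it. -/
theorem mem_convexHull_filter_of_forall_inner_le {s : Finset E} {x w : E}
    (hx : x ∈ convexHull ℝ (s : Set E)) (hw : ∀ y ∈ s, inner ℝ y w ≤ inner ℝ x w) :
    x ∈ convexHull ℝ ((s.filter fun y => inner ℝ y w = inner ℝ x w : Finset E) : Set E) := by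
  classical
  obtain ⟨a, ha0, ha1, hax⟩ := Finset.mem_convexHull'.1 hx
  have hsum : ∑ y ∈ s, a y * (inner ℝ x w - inner ℝ y w) = 0 := by
    have h1 : ∑ y ∈ s, a y * inner ℝ y w = inner ℝ x w := by
      rw [← hax, sum_inner]
      simp [inner_smul_left]
    simp only [mul_sub, Finset.sum_sub_distrib, ← Finset.sum_mul, ha1, h1, one_mul, sub_self]
  have hzero : ∀ y ∈ s, inner ℝ y w ≠ inner ℝ x w → a y = 0 := by
    intro y hy hne
    have := (Finset.sum_eq_zero_iff_of_nonneg fun z hz =>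
      mul_nonneg (ha0 z hz) (sub_nonneg.2 (hw z hz))).1 hsum y hy
    rcases mul_eq_zero.1 this with h | h
    · exact h
    · exact absurd (sub_eq_zero.1 h).symm hne
  refine Finset.mem_convexHull'.2 ⟨a, fun y hy => ha0 y (Finset.mem_filter.1 hy).1, ?_, ?_⟩
  · rw [← ha1]
    refine Finset.sum_subset (Finset.filter_subset _ _) fun y hy hy' => hzero y hy fun h => ?_
    exact hy' (Finset.mem_filter.2 ⟨hy, h⟩)
  · refine (Finset.sum_subset (Finset.filter_subset _ _) fun y hy hy' => ?_).trans hax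
    rw [hzero y hy fun h => hy' (Finset.mem_filter.2 ⟨hy, h⟩), zero_smul]

theorem inner_eq_of_mem_convexHull {s : Set E} {w : E} {c : ℝ} (hs : ∀ y ∈ s, inner ℝ y w = c)
    {x : E} (hx : x ∈ convexHull ℝ s) : inner ℝ x w = c := by
  refine convexHull_min (t := {x | inner ℝ x w = c}) hs ?_ hx
  have := convex_hyperplane (𝕜 := ℝ) (f := fun x : E => inner ℝ x w)
    ⟨fun x y => inner_add_left x y w, fun a x => by simp [inner_smul_left]⟩ c
  exact this

/-- A closed ball about the origin inside `P` bounds the distance from the origin to a supporting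
hyperplane from below. -/
theorem le_inner_of_closedBall_subset {P : Set E} {r : ℝ} (hr : 0 ≤ r)
    (hP : Metric.closedBall 0 r ⊆ P) {x w : E} (hw : ‖w‖ = 1)
    (h : ∀ y ∈ P, inner ℝ y w ≤ inner ℝ x w) : r ≤ inner ℝ x w := by
  have := h (r • w) (hP (by simp [norm_smul, hw, abs_of_nonneg hr]))
  rwa [inner_smul_left, real_inner_self_eq_norm_sq, hw, conj_trivial, one_pow, mul_one] at this

/-- A boundary point of a convex set with interior points has an outer unit normal. -/
theorem exists_unit_normal [CompleteSpace E] {P : Set E} (hP : Convex ℝ P)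
    (h0 : 0 ∈ interior P) {x : E} (hx : x ∈ frontier P) :
    ∃ w : E, ‖w‖ = 1 ∧ ∀ y ∈ P, inner ℝ y w ≤ inner ℝ x w := by
  obtain ⟨f, hf⟩ := geometric_hahn_banach_open_point hP.interior isOpen_interior hx.2
  have hle : ∀ y ∈ P, f y ≤ f x := by
    intro y hy
    have hy' : y ∈ closure (interior P) := by
      rw [hP.closure_interior_eq_closure_of_nonempty_interior ⟨0, h0⟩]
      exact subset_closure hy
    exact closure_minimal (fun z hz => (hf z hz).le)
      (isClosed_le f.continuous continuous_const) hy'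
  have hfx : 0 < f x := by simpa using hf 0 h0
  set w := (InnerProductSpace.toDual ℝ E).symm f with hw
  have hfw : ∀ y, inner ℝ y w = f y := fun y => by
    rw [real_inner_comm, hw, InnerProductSpace.toDual_symm_apply]
  have hw0 : w ≠ 0 := by
    intro h
    have := hfw x
    rw [h, inner_zero_right] at this
    exact hfx.ne this
  refine ⟨‖w‖⁻¹ • w, by
    rw [norm_smul, norm_inv, norm_norm, inv_mul_cancel₀ (norm_ne_zero_iff.2 hw0)], fun y hy => ?_⟩
  rw [inner_smul_right, inner_smul_right, hfw, hfw]
  exact mul_le_mul_of_nonneg_left (hle y hy) (by positivity)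

theorem not_mem_interior_of_forall_inner_le {P : Set E} {x w : E} (hw : ‖w‖ = 1)
    (h : ∀ y ∈ P, inner ℝ y w ≤ inner ℝ x w) : x ∉ interior P := by
  intro hx
  obtain ⟨ε, hε, hb⟩ := Metric.nhds_basis_closedBall.mem_iff.1 (mem_interior_iff_mem_nhds.1 hx)
  have := h (x + ε • w) (hb (by simp [norm_smul, hw, abs_of_pos hε]))
  rw [inner_add_left, inner_smul_left, real_inner_self_eq_norm_sq, hw, conj_trivial] at this
  linarith

/-- Every point of a small ball about a negative multiple of `v` is `ρ • x` for a boundary point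
`x` all of whose outer normals point away from `v`. -/
theorem exists_ball_subset_cone_of_normal_neg [CompleteSpace E] {P : Set E} (hP : Convex ℝ P)
    (hPc : IsCompact P) (h0 : 0 ∈ interior P) {v : E} (hv : ‖v‖ = 1) :
    ∃ (c : E) (η : ℝ), 0 < η ∧ ∀ y ∈ Metric.ball c η, ∃ ρ : ℝ, 0 < ρ ∧ ρ ≤ 1 ∧ ∃ x ∈ frontier P,
      y = ρ • x ∧ ∀ w : E, ‖w‖ = 1 → (∀ z ∈ P, inner ℝ z w ≤ inner ℝ x w) → inner ℝ w v < 0 := by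
  have hnhds : P ∈ nhds (0 : E) := mem_interior_iff_mem_nhds.1 h0
  obtain ⟨r, hr, hrP⟩ := Metric.nhds_basis_closedBall.mem_iff.1 hnhds
  obtain ⟨R, hR⟩ := isBounded_iff_forall_norm_le.1 hPc.isBounded
  have hR0 : 0 < R := by
    have h1 := hR (r • v) (hrP (by simp [norm_smul, hv, abs_of_pos hr]))
    rw [norm_smul, hv, mul_one, Real.norm_of_nonneg hr.le] at h1
    linarith
  -- the ball has centre `-(r / 2) • v`; its radius `η` satisfies `η * R < (r / 2 - η) * r`, the
  -- inequality that makes every relevant normal point away from `v`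
  set η := r / 2 * r / (2 * (R + r)) with hη
  have hη0 : 0 < η := by positivity
  have hηr : η * (R + r) = r / 2 * r / 2 := by
    rw [hη]
    field_simp
  have hηlt : η < r / 2 := by nlinarith
  refine ⟨-((r / 2) • v), η, hη0, fun y hy => ?_⟩
  have hyz : ‖y + (r / 2) • v‖ < η := by simpa [dist_eq_norm] using hy
  have hrv : ‖(r / 2) • v‖ = r / 2 := by
    rw [norm_smul, hv, mul_one, Real.norm_of_nonneg (by positivity)]
  have hylow : r / 2 - η < ‖y‖ := by
    have h1 : ‖(r / 2) • v‖ ≤ ‖y + (r / 2) • v‖ + ‖y‖ := by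
      simpa using norm_sub_le (y + (r / 2) • v) y
    linarith
  have hyup : ‖y‖ ≤ r := by
    have h1 : ‖y‖ ≤ ‖y + (r / 2) • v‖ + ‖(r / 2) • v‖ := by
      simpa using norm_sub_le (y + (r / 2) • v) ((r / 2) • v)
    linarith
  have hyP : y ∈ P := hrP (by simpa using hyup)
  have hy0 : y ≠ 0 := by
    rintro rfl
    rw [norm_zero] at hylow
    linarith
  have hg0 : 0 < gauge P y :=
    (gauge_pos (absorbent_nhds_zero hnhds)
      (NormedSpace.isVonNBounded_of_isBounded ℝ hPc.isBounded)).2 hy0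
  have hx : (gauge P y)⁻¹ • y ∈ frontier P := by
    rw [← gauge_eq_one_iff_mem_frontier hP hnhds, gauge_smul_of_nonneg (by positivity), smul_eq_mul,
      inv_mul_cancel₀ hg0.ne']
  have hyx : y = gauge P y • (gauge P y)⁻¹ • y := by
    rw [smul_smul, mul_inv_cancel₀ hg0.ne', one_smul]
  refine ⟨gauge P y, hg0, gauge_le_one_of_mem hyP, _, hx, hyx, ?_⟩
  generalize (gauge P y)⁻¹ • y = x at hx hyx
  generalize gauge P y = ρ at hyx hg0
  intro w hw hnorm
  have h1 : r ≤ inner ℝ x w := le_inner_of_closedBall_subset hr.le hrP hw hnorm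
  have h2 : ‖x‖ ≤ R := hR x (hPc.isClosed.frontier_subset hx)
  have h3 : ‖y‖ = ρ * ‖x‖ := by rw [hyx, norm_smul, Real.norm_of_nonneg hg0.le]
  have h4 : inner ℝ y w = ρ * inner ℝ x w := by rw [hyx, inner_smul_left, conj_trivial]
  have h5 : inner ℝ (y + (r / 2) • v) w ≤ ‖y + (r / 2) • v‖ := by
    simpa [hw] using real_inner_le_norm (y + (r / 2) • v) w
  rw [inner_add_left, inner_smul_left, conj_trivial, real_inner_comm] at h5
  rw [real_inner_comm] at h4
  have h6 : r / 2 - η < ρ * R := by nlinarith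
  have h7 : ρ * r ≤ inner ℝ w y := by rw [h4]; nlinarith
  rw [real_inner_comm]
  by_contra! hcon
  have h8 : ρ * r < η := by nlinarith
  have h9 : (r / 2 - η) * r < η * R := by nlinarith
  nlinarith

end Normals

section Necessity

variable {n : ℕ}

/-- A polytope with the origin in its interior has a facet, of positive area, whose outer normal
points away from a given direction `v`. -/
theorem exists_regular_subset_of_normal_neg {s : Finset (EuclideanSpace ℝ (Fin n))}
    (h0 : 0 ∈ interior (convexHull ℝ (s : Set (EuclideanSpace ℝ (Fin n)))))
    {v : EuclideanSpace ℝ (Fin n)} (hv : ‖v‖ = 1) :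
    ∃ (w : EuclideanSpace ℝ (Fin n)) (c : ℝ) (B : Set (EuclideanSpace ℝ (Fin n))),
      ‖w‖ = 1 ∧ 0 < c ∧ inner ℝ w v < 0 ∧ MeasurableSet B ∧
      Measure.euclideanHausdorffMeasure (n - 1) B ≠ 0 ∧
      ∀ x ∈ B, inner ℝ x w = c ∧
        x ∈ frontier (convexHull ℝ (s : Set (EuclideanSpace ℝ (Fin n)))) ∧
        IsOuterUnitNormal (convexHull ℝ (s : Set (EuclideanSpace ℝ (Fin n)))) x w ∧
        ∀ w', IsOuterUnitNormal (convexHull ℝ (s : Set (EuclideanSpace ℝ (Fin n)))) x w' →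
          w' = w := by
  classical
  set P := convexHull ℝ (s : Set (EuclideanSpace ℝ (Fin n))) with hPdef
  have hP : Convex ℝ P := convex_convexHull ℝ _
  have hPc : IsCompact P := s.finite_toSet.isCompact_convexHull ℝ
  obtain ⟨r, hr, hrP⟩ :=
    Metric.nhds_basis_closedBall.mem_iff.1 (mem_interior_iff_mem_nhds.1 h0)
  -- the faces that are seen from the direction `-v`, recorded by their vertices and normal
  let IsFace : Finset (EuclideanSpace ℝ (Fin n)) → EuclideanSpace ℝ (Fin n) → ℝ → Prop :=
    fun T w c => T ⊆ s ∧ ‖w‖ = 1 ∧ 0 < c ∧ inner ℝ w v < 0 ∧ (∀ y ∈ P, inner ℝ y w ≤ c) ∧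
      ∀ y ∈ T, inner ℝ y w = c
  obtain ⟨T, w, c, hface, hpos⟩ : ∃ T w c, IsFace T w c ∧
      volume (truncatedCone (convexHull ℝ (T : Set (EuclideanSpace ℝ (Fin n))))) ≠ 0 := by
    by_contra! hcon
    obtain ⟨a, η, hη, hball⟩ := exists_ball_subset_cone_of_normal_neg hP hPc h0 hv
    have hsub : Metric.ball a η ⊆ ⋃ T ∈ (s.powerset.filter (fun T => ∃ w c, IsFace T w c) :
        Finset (Finset (EuclideanSpace ℝ (Fin n)))),
          truncatedCone (convexHull ℝ (T : Set (EuclideanSpace ℝ (Fin n)))) := by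
      intro y hy
      obtain ⟨ρ, hρ0, hρ1, x, hx, hyx, hneg⟩ := hball y hy
      obtain ⟨w, hw, hwx⟩ := exists_unit_normal hP h0 hx
      have hxP : x ∈ P := hPc.isClosed.frontier_subset hx
      refine Set.mem_biUnion (x := s.filter fun y => inner ℝ y w = inner ℝ x w) ?_
        ⟨ρ, hρ0, hρ1, x, ?_, hyx⟩
      · simp only [Finset.coe_filter, Finset.mem_powerset, Set.mem_ofPred_eq]
        refine ⟨Finset.filter_subset _ _, w, inner ℝ x w, Finset.filter_subset _ _, hw, ?_,
          hneg w hw hwx, hwx, fun y hy => (Finset.mem_filter.1 hy).2⟩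
        exact hr.trans_le (le_inner_of_closedBall_subset hr.le hrP hw hwx)
      · exact mem_convexHull_filter_of_forall_inner_le hxP
          fun y hy => hwx y (subset_convexHull ℝ _ hy)
    have hnull : volume (Metric.ball a η) = 0 := by
      refine measure_mono_null hsub ((measure_biUnion_null_iff
        (Finset.countable_toSet _)).2 fun T hT => ?_)
      obtain ⟨-, w, c, h⟩ := Finset.mem_filter.1 hT
      exact hcon T w c h
    exact (Metric.measure_ball_pos volume a hη).ne' hnull
  obtain ⟨hTs, hw, hc, hwv, hle, hTw⟩ := hface
  -- the points of the face that lie on no lower-dimensional face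
  let bad : Finset (Finset (EuclideanSpace ℝ (Fin n))) := s.powerset.filter fun T' =>
    volume (truncatedCone (convexHull ℝ (T' : Set (EuclideanSpace ℝ (Fin n))))) = 0
  let B := convexHull ℝ (T : Set (EuclideanSpace ℝ (Fin n))) \
    ⋃ T' ∈ bad, convexHull ℝ (T' : Set (EuclideanSpace ℝ (Fin n)))
  have hcl : ∀ T' : Finset (EuclideanSpace ℝ (Fin n)),
      MeasurableSet (convexHull ℝ (T' : Set (EuclideanSpace ℝ (Fin n)))) :=
    fun T' => (T'.finite_toSet.isCompact_convexHull ℝ).isClosed.measurableSet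
  have hBm : MeasurableSet B := (hcl T).diff (Finset.measurableSet_biUnion _ fun T' _ => hcl T')
  have hBw : ∀ x ∈ B, inner ℝ x w = c := fun x hx =>
    inner_eq_of_mem_convexHull hTw hx.1
  refine ⟨w, c, B, hw, hc, hwv, hBm, ?_, fun x hx => ⟨hBw x hx, ?_, ?_, ?_⟩⟩
  · intro hB0
    have hconeB : volume (truncatedCone B) = 0 := by
      rw [volume_truncatedCone hBm hw hc hBw, finrank_euclideanSpace_fin, hB0, mul_zero]
    refine hpos (measure_mono_null ?_ (measure_union_null hconeB
      ((measure_biUnion_null_iff (Finset.countable_toSet bad)).2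
        fun T' hT' => (Finset.mem_filter.1 hT').2)))
    rintro y ⟨ρ, hρ0, hρ1, x, hx, rfl⟩
    by_cases hxb : x ∈ ⋃ T' ∈ bad, convexHull ℝ (T' : Set (EuclideanSpace ℝ (Fin n)))
    · obtain ⟨T', hT', hxT'⟩ := Set.mem_iUnion₂.1 hxb
      exact Or.inr (Set.mem_biUnion hT' ⟨ρ, hρ0, hρ1, x, hxT', rfl⟩)
    · exact Or.inl ⟨ρ, hρ0, hρ1, x, ⟨hx, hxb⟩, rfl⟩
  · refine ⟨subset_closure (convexHull_mono hTs hx.1), ?_⟩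
    exact not_mem_interior_of_forall_inner_le hw fun y hy => (hle y hy).trans_eq (hBw x hx).symm
  · exact ⟨hw, fun y hy => (hle y hy).trans_eq (hBw x hx).symm⟩
  · rintro w' ⟨hw', hle'⟩
    by_contra hne
    have hc' : 0 < inner ℝ x w' :=
      hr.trans_le (le_inner_of_closedBall_subset hr.le hrP hw' hle')
    have hxT' := mem_convexHull_filter_of_forall_inner_le hx.1
      fun y hy => hle' y (subset_convexHull ℝ _ (hTs hy))
    refine hx.2 (Set.mem_biUnion (Finset.mem_filter.2 ⟨Finset.mem_powerset.2
      ((Finset.filter_subset _ _).trans hTs), ?_⟩) hxT')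
    -- two supporting hyperplanes with different normals confine the cone to a linear hyperplane
    have hd : c⁻¹ • w - (inner ℝ x w')⁻¹ • w' ≠ 0 := by
      intro hd
      rw [sub_eq_zero] at hd
      have hn := congrArg norm hd
      rw [norm_smul, norm_smul, hw, hw', mul_one, mul_one,
        Real.norm_of_nonneg (by positivity), Real.norm_of_nonneg (by positivity)] at hn
      rw [← hn] at hd
      exact hne (smul_right_injective _ (inv_pos.2 hc).ne' hd).symm
    refine measure_mono_null ?_ (volume_inner_eq_zero hd)
    rintro y ⟨ρ, -, -, z, hz, rfl⟩
    have hz1 : inner ℝ z w = c := by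
      refine inner_eq_of_mem_convexHull (fun y hy => ?_) hz
      exact hTw y (Finset.mem_filter.1 hy).1
    have hz2 : inner ℝ z w' = inner ℝ x w' := by
      refine inner_eq_of_mem_convexHull (fun y hy => ?_) hz
      exact (Finset.mem_filter.1 hy).2
    simp only [Set.mem_ofPred_eq, inner_smul_left, inner_sub_right, inner_smul_right, hz1, hz2]
    field_simp
    simp

theorem gaussMap_eq {K : Set (EuclideanSpace ℝ (Fin n))} {x w : EuclideanSpace ℝ (Fin n)}
    (hw : IsOuterUnitNormal K x w) (h : ∀ w', IsOuterUnitNormal K x w' → w' = w) :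
    gaussMap K x = w :=
  h _ (Classical.epsilon_spec ⟨w, hw⟩)

/-- The `L_p` surface area measure of a polytope charges every open hemisphere. -/
theorem lpSurfaceArea_ne_zero_of_isPolytope (p : ℝ) {P : Set (EuclideanSpace ℝ (Fin n))}
    (hP : IsPolytope P) (h0 : 0 ∈ interior P)
    (v : Metric.sphere (0 : EuclideanSpace ℝ (Fin n)) 1) :
    lpSurfaceArea p P (closedHemisphere v)ᶜ ≠ 0 := by
  obtain ⟨⟨s, rfl⟩, -⟩ := hP
  obtain ⟨w, c, B, hw, hc, hwv, hBm, hB0, hB⟩ :=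
    exists_regular_subset_of_normal_neg h0 (v := v) (by simp)
  have hgauss : ∀ x ∈ B, gaussMap (convexHull ℝ (s : Set (EuclideanSpace ℝ (Fin n)))) x = w :=
    fun x hx => gaussMap_eq (hB x hx).2.2.1 (hB x hx).2.2.2
  have hsub : B ⊆ gaussPreimage (convexHull ℝ (s : Set (EuclideanSpace ℝ (Fin n))))
      (closedHemisphere v)ᶜ := by
    intro x hx
    obtain ⟨-, hx1, hx2, hx3⟩ := hB x hx
    refine ⟨⟨hx1, w, hx2, hx3⟩, ⟨w, by simp [hw]⟩, ?_, (hgauss x hx).symm⟩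
    simpa [closedHemisphere] using hwv
  intro hzero
  have h1 := le_antisymm ((lintegral_mono_set hsub).trans_eq hzero) zero_le
  rw [setLIntegral_congr_fun (g := fun _ => ENNReal.ofReal (c ^ (1 - p))) hBm
    (fun x hx => by simp only [hgauss x hx, (hB x hx).1]), setLIntegral_const] at h1
  rcases mul_eq_zero.1 h1 with h | h
  · exact absurd (ENNReal.ofReal_eq_zero.1 h) (not_le.2 (Real.rpow_pos_of_pos hc _))
  · exact hB0 h

end Necessity

/-! ### Intersections of half-spaces and their facets -/

section Wulff

variable {E : Type*} [NormedAddCommGroup E] [InnerProductSpace ℝ E] {ι : Type*}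

/-- The intersection of the half-spaces `{x | x · u k ≤ h k}`. The numbers `h k` need not be
support numbers: a constraint may be inactive, and the set may be empty. -/
def wulff (u : ι → E) (h : ι → ℝ) : Set E :=
  {x | ∀ k, inner ℝ x (u k) ≤ h k}

/-- The points of `wulff u h` at which `k` is the only active constraint. -/
def openFacet (u : ι → E) (h : ι → ℝ) (k : ι) : Set E :=
  {x | inner ℝ x (u k) = h k ∧ ∀ j, j ≠ k → inner ℝ x (u j) < h j}

/-- For `h > 0`, the closed cone with apex `0` over the `k`-th facet of `wulff u h`, described as
the set on which the `k`-th of the functions `x ↦ (x · u j) / h j` is the largest one. -/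
def sector (u : ι → E) (h : ι → ℝ) (k : ι) : Set E :=
  {x | x ∈ wulff u h ∧ ∀ j, inner ℝ x (u j) / h j ≤ inner ℝ x (u k) / h k}

theorem isClosed_wulff (u : ι → E) (h : ι → ℝ) : IsClosed (wulff u h) := by
  have : wulff u h = ⋂ k, {x | inner ℝ x (u k) ≤ h k} := by
    ext
    simp [wulff]
  rw [this]
  exact isClosed_iInter fun k => isClosed_le (by fun_prop) continuous_const

theorem convex_wulff (u : ι → E) (h : ι → ℝ) : Convex ℝ (wulff u h) := by
  intro x hx y hy a b ha hb hab k
  rw [inner_add_left, inner_smul_left, inner_smul_left, conj_trivial, conj_trivial]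
  calc a * inner ℝ x (u k) + b * inner ℝ y (u k) ≤ a * h k + b * h k := by
        gcongr
        · exact hx k
        · exact hy k
    _ = h k := by rw [← add_mul, hab, one_mul]

theorem isOpen_setOf_forall_inner_lt [Finite ι] (u : ι → E) (h : ι → ℝ) :
    IsOpen {x : E | ∀ k, inner ℝ x (u k) < h k} := by
  have : {x : E | ∀ k, inner ℝ x (u k) < h k} = ⋂ k, {x | inner ℝ x (u k) < h k} := by
    ext
    simp
  rw [this]
  exact isOpen_iInter_of_finite fun k => isOpen_lt (by fun_prop) continuous_const

theorem mem_interior_wulff [Finite ι] {u : ι → E} {h : ι → ℝ} {x : E}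
    (hx : ∀ k, inner ℝ x (u k) < h k) : x ∈ interior (wulff u h) :=
  interior_maximal (fun _ hy k => (hy k).le) (isOpen_setOf_forall_inner_lt u h) hx

theorem zero_mem_interior_wulff [Finite ι] {u : ι → E} {h : ι → ℝ} (hh : ∀ k, 0 < h k) :
    0 ∈ interior (wulff u h) :=
  mem_interior_wulff fun k => by simpa using hh k

theorem openFacet_subset_wulff (u : ι → E) (h : ι → ℝ) (k : ι) :
    openFacet u h k ⊆ wulff u h := by
  intro x hx j
  rcases eq_or_ne j k with rfl | hj
  · exact hx.1.le
  · exact (hx.2 j hj).le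

theorem openFacet_eq (u : ι → E) (h : ι → ℝ) (k : ι) :
    openFacet u h k = {x | inner ℝ x (u k) = h k} ∩
      {x | ∀ j : {j // j ≠ k}, inner ℝ x (u j) < h j} := by
  ext x
  simp [openFacet]

theorem measurableSet_openFacet [Finite ι] [MeasurableSpace E] [OpensMeasurableSpace E]
    (u : ι → E) (h : ι → ℝ) (k : ι) : MeasurableSet (openFacet u h k) := by
  rw [openFacet_eq]
  exact (isClosed_eq (by fun_prop) continuous_const).measurableSet.inter
    (isOpen_setOf_forall_inner_lt (fun j : {j // j ≠ k} => u j) fun j => h j).measurableSet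

/-- Unit vectors that positively span the space do so with a uniform bound. -/
theorem exists_pos_forall_exists_mul_norm_le_inner [FiniteDimensional ℝ E] [Nontrivial E]
    [Fintype ι] {u : ι → E} (hu : ∀ v : E, v ≠ 0 → ∃ k, 0 < inner ℝ v (u k)) :
    ∃ c : ℝ, 0 < c ∧ ∀ x : E, ∃ k, c * ‖x‖ ≤ inner ℝ x (u k) := by
  obtain ⟨v₀, hv₀⟩ := exists_ne (0 : E)
  obtain ⟨k₀, -⟩ := hu v₀ hv₀
  have hne : (Finset.univ : Finset ι).Nonempty := ⟨k₀, Finset.mem_univ _⟩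
  have hcont : Continuous fun x : E => Finset.univ.sup' hne fun k => inner ℝ x (u k) :=
    Continuous.finset_sup'_apply hne fun k _ => by fun_prop
  obtain ⟨x₀, hx₀, hmin⟩ := (isCompact_sphere (0 : E) 1).exists_isMinOn
    (NormedSpace.sphere_nonempty.2 zero_le_one) hcont.continuousOn
  have hx₀' : x₀ ≠ 0 := by
    rintro rfl
    simp at hx₀
  refine ⟨Finset.univ.sup' hne fun k => inner ℝ x₀ (u k), ?_, fun x => ?_⟩
  · obtain ⟨k, hk⟩ := hu x₀ hx₀'
    exact (Finset.lt_sup'_iff hne).2 ⟨k, Finset.mem_univ k, hk⟩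
  · rcases eq_or_ne x 0 with rfl | hx
    · exact ⟨k₀, by simp⟩
    · have hn : 0 < ‖x‖ := norm_pos_iff.2 hx
      have hs : ‖x‖⁻¹ • x ∈ Metric.sphere (0 : E) 1 := by
        simp [norm_smul, hn.ne']
      obtain ⟨k, -, hk⟩ := (Finset.le_sup'_iff hne).1 (isMinOn_iff.1 hmin _ hs)
      refine ⟨k, ?_⟩
      rw [inner_smul_left, conj_trivial] at hk
      calc _ ≤ ‖x‖⁻¹ * inner ℝ x (u k) * ‖x‖ := mul_le_mul_of_nonneg_right hk hn.le
        _ = inner ℝ x (u k) := by field_simp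

theorem isCompact_wulff [FiniteDimensional ℝ E] [Nontrivial E] [Fintype ι] {u : ι → E}
    (hu : ∀ v : E, v ≠ 0 → ∃ k, 0 < inner ℝ v (u k)) (h : ι → ℝ) : IsCompact (wulff u h) := by
  obtain ⟨c, hc, hle⟩ := exists_pos_forall_exists_mul_norm_le_inner hu
  refine Metric.isCompact_of_isClosed_isBounded (isClosed_wulff u h)
    (isBounded_iff_forall_norm_le.2 ⟨(∑ k, |h k|) / c, fun x hx => ?_⟩)
  obtain ⟨k, hk⟩ := hle x
  rw [le_div_iff₀ hc, mul_comm]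
  calc c * ‖x‖ ≤ inner ℝ x (u k) := hk
    _ ≤ h k := hx k
    _ ≤ |h k| := le_abs_self _
    _ ≤ ∑ k, |h k| := Finset.single_le_sum (f := fun k => |h k|) (fun j _ => abs_nonneg _)
        (Finset.mem_univ k)

/-- An extreme point is determined by its set of active constraints, so there are finitely many. -/
theorem finite_extremePoints_wulff [Fintype ι] (u : ι → E) (h : ι → ℝ) :
    ((wulff u h).extremePoints ℝ).Finite := by
  classical
  refine Set.Finite.of_injOn (f := fun x => Finset.univ.filter fun k => inner ℝ x (u k) = h k)
    (t := Set.univ) (fun _ _ => Set.mem_univ _) ?_ Set.finite_univ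
  intro x hx y hy hxy
  have hact : ∀ k, inner ℝ x (u k) = h k → inner ℝ y (u k) = h k := fun k hk => by
    simpa using (Finset.ext_iff.1 hxy k).1 (by simp [hk])
  by_contra hne
  -- `x` can be moved a little beyond itself on the line through `y`
  have hev : ∀ᶠ ε : ℝ in nhdsWithin 0 (Set.Ioi 0), x + ε • (x - y) ∈ wulff u h := by
    have : ∀ k, ∀ᶠ ε : ℝ in nhdsWithin 0 (Set.Ioi 0), inner ℝ (x + ε • (x - y)) (u k) ≤ h k := by
      intro k
      rcases (hx.1 k).lt_or_eq with hlt | heq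
      · have hc : Continuous fun ε : ℝ => inner ℝ (x + ε • (x - y)) (u k) := by fun_prop
        have := (hc.tendsto 0).eventually_lt_const (u := h k) (by simpa using hlt)
        exact (this.filter_mono nhdsWithin_le_nhds).mono fun ε hε => hε.le
      · refine Filter.Eventually.of_forall fun ε => ?_
        simp [inner_add_left, inner_smul_left, inner_sub_left, hact k heq, heq]
    exact Filter.eventually_all.2 this
  obtain ⟨ε, hεP, hε⟩ := (hev.and self_mem_nhdsWithin).exists
  have hε0 : 0 < ε := hε
  have hseg : x ∈ openSegment ℝ y (x + ε • (x - y)) := by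
    refine ⟨ε / (1 + ε), 1 / (1 + ε), by positivity, by positivity, by field_simp; ring, ?_⟩
    have h1 : (1 / (1 + ε)) • (x + ε • (x - y)) = x - (ε / (1 + ε)) • y := by
      have : x + ε • (x - y) = (1 + ε) • x - ε • y := by module
      rw [this, smul_sub, smul_smul, smul_smul]
      rw [show 1 / (1 + ε) * (1 + ε) = 1 by field_simp, one_smul,
        show 1 / (1 + ε) * ε = ε / (1 + ε) by ring]
    rw [h1]
    abel
  exact hne (hx.2 hy.1 hεP hseg).symm

theorem exists_finset_wulff_eq_convexHull [FiniteDimensional ℝ E] [Nontrivial E] [Fintype ι]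
    {u : ι → E} (hu : ∀ v : E, v ≠ 0 → ∃ k, 0 < inner ℝ v (u k)) (h : ι → ℝ) :
    ∃ s : Finset E, wulff u h = convexHull ℝ (s : Set E) := by
  have hfin := finite_extremePoints_wulff u h
  refine ⟨hfin.toFinset, ?_⟩
  rw [hfin.coe_toFinset, ← (hfin.isCompact_convexHull ℝ).isClosed.closure_eq,
    closure_convexHull_extremePoints (isCompact_wulff hu h) (convex_wulff u h)]

/-- In the relative interior of the `k`-th facet, `u k` is the only outer unit normal. -/
theorem eq_of_mem_openFacet_of_forall_inner_le [Finite ι] {u : ι → E} {h : ι → ℝ} {k : ι} {x : E}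
    (huk : ‖u k‖ = 1) (hx : x ∈ openFacet u h k) {w : E} (hw : ‖w‖ = 1)
    (hle : ∀ y ∈ wulff u h, inner ℝ y w ≤ inner ℝ x w) : w = u k := by
  -- a direction in which `x` can be moved inside `wulff u h` makes no acute angle with `w`
  have hdir : ∀ d : E, inner ℝ d (u k) ≤ 0 → inner ℝ d w ≤ 0 := by
    intro d hd
    have hev : ∀ᶠ ε : ℝ in nhdsWithin 0 (Set.Ioi 0), ∀ j, inner ℝ (x + ε • d) (u j) ≤ h j := by
      refine Filter.eventually_all.2 fun j => ?_
      rcases eq_or_ne j k with rfl | hj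
      · filter_upwards [self_mem_nhdsWithin] with ε hε
        have hε0 : 0 < ε := hε
        rw [inner_add_left, inner_smul_left, conj_trivial, hx.1]
        nlinarith
      · have hc : Continuous fun ε : ℝ => inner ℝ (x + ε • d) (u j) := by fun_prop
        have := (hc.tendsto 0).eventually_lt_const (u := h j) (by simpa using hx.2 j hj)
        exact (this.filter_mono nhdsWithin_le_nhds).mono fun ε hε => hε.le
    obtain ⟨ε, hεP, hε⟩ := (hev.and self_mem_nhdsWithin).exists
    have hε0 : 0 < ε := hε
    have := hle _ hεP
    rw [inner_add_left, inner_smul_left, conj_trivial] at this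
    by_contra! hcon
    nlinarith
  have hkk : inner ℝ (u k) (u k) = (1 : ℝ) := by rw [real_inner_self_eq_norm_sq, huk, one_pow]
  have hww : inner ℝ w w = (1 : ℝ) := by rw [real_inner_self_eq_norm_sq, hw, one_pow]
  have h1 : inner ℝ (w - (inner ℝ w (u k) : ℝ) • u k) w ≤ 0 := by
    refine hdir _ (le_of_eq ?_)
    rw [inner_sub_left, inner_smul_left, conj_trivial, hkk]
    ring
  have h2 : inner ℝ (-u k) w ≤ 0 := hdir _ (by rw [inner_neg_left, hkk]; norm_num)
  rw [inner_sub_left, inner_smul_left, conj_trivial, hww, real_inner_comm w (u k)] at h1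
  rw [inner_neg_left, real_inner_comm w (u k)] at h2
  have h3 : 1 ≤ inner ℝ w (u k) := by nlinarith
  have h4 : ‖w - u k‖ ^ 2 ≤ 0 := by
    rw [← real_inner_self_eq_norm_sq, inner_sub_left, inner_sub_right, inner_sub_right, hkk, hww,
      real_inner_comm w (u k)]
    linarith
  have h5 : ‖w - u k‖ = 0 := by
    have := norm_nonneg (w - u k)
    nlinarith
  exact sub_eq_zero.1 (norm_eq_zero.1 h5)

theorem pairwise_disjoint_truncatedCone_openFacet (u : ι → E) {h : ι → ℝ} (hh : ∀ k, 0 < h k) :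
    Pairwise fun i j => Disjoint (truncatedCone (openFacet u h i))
      (truncatedCone (openFacet u h j)) := by
  have key : ∀ i j, i ≠ j → ∀ y ∈ truncatedCone (openFacet u h i),
      inner ℝ y (u j) / h j < inner ℝ y (u i) / h i := by
    rintro i j hij _ ⟨ρ, hρ, -, x, hx, rfl⟩
    rw [inner_smul_left, inner_smul_left, conj_trivial, hx.1, div_lt_div_iff₀ (hh j) (hh i)]
    have := mul_lt_mul_of_pos_left (hx.2 j hij.symm) (mul_pos hρ (hh i))
    nlinarith
  intro i j hij
  exact Set.disjoint_left.2 fun y hi hj => (key i j hij y hi).not_gt (key j i hij.symm y hj)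

theorem truncatedCone_openFacet_subset_wulff (u : ι → E) {h : ι → ℝ} (hh : ∀ k, 0 < h k) (k : ι) :
    truncatedCone (openFacet u h k) ⊆ wulff u h := by
  rintro _ ⟨ρ, hρ0, hρ1, x, hx, rfl⟩ j
  have := openFacet_subset_wulff u h k hx j
  rw [inner_smul_left, conj_trivial]
  nlinarith [hh j]

variable [FiniteDimensional ℝ E] [MeasurableSpace E] [BorelSpace E]

theorem sum_volume_truncatedCone_openFacet_le [Fintype ι] (u : ι → E)
    {h : ι → ℝ} (hh : ∀ k, 0 < h k) :
    ∑ k, volume (truncatedCone (openFacet u h k)) ≤ volume (wulff u h) := by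
  rw [← measure_biUnion_finset (s := Finset.univ)
    (fun i _ j _ hij => pairwise_disjoint_truncatedCone_openFacet u hh hij) fun k _ =>
    measurableSet_truncatedCone (measurableSet_openFacet u h k) (hh k) fun x hx => hx.1]
  exact measure_mono (Set.iUnion₂_subset fun k _ => truncatedCone_openFacet_subset_wulff u hh k)

/-- Up to the null set where two of the functions `x ↦ (x · u j) / h j` agree, a sector is the cone
over the relative interior of a facet. -/
theorem volume_sector_le [Fintype ι] {u : ι → E} (hu1 : ∀ k, ‖u k‖ = 1)
    (huinj : Function.Injective u) (hu : ∀ v : E, v ≠ 0 → ∃ k, 0 < inner ℝ v (u k)) {h : ι → ℝ}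
    (hh : ∀ k, 0 < h k) (k : ι) :
    volume (sector u h k) ≤ volume (truncatedCone (openFacet u h k)) := by
  classical
  let N : Set E := {x | inner ℝ x (u k) = 0} ∪
    ⋃ j ∈ Finset.univ.erase k, {x | inner ℝ x ((h j)⁻¹ • u j - (h k)⁻¹ • u k) = 0}
  have hu0 : u k ≠ 0 := by
    intro h0
    have := hu1 k
    simp [h0] at this
  have hN : volume N = 0 := by
    refine measure_union_null (volume_inner_eq_zero hu0)
      ((measure_biUnion_null_iff (Finset.countable_toSet _)).2 fun j hj => ?_)
    refine volume_inner_eq_zero fun h0 => (Finset.mem_erase.1 hj).1 (huinj ?_)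
    rw [sub_eq_zero] at h0
    have hn := congrArg norm h0
    rw [norm_smul, norm_smul, hu1, hu1, mul_one, mul_one,
      Real.norm_of_nonneg (inv_pos.2 (hh j)).le, Real.norm_of_nonneg (inv_pos.2 (hh k)).le] at hn
    rw [hn] at h0
    exact smul_right_injective _ (inv_pos.2 (hh k)).ne' h0
  refine (measure_mono (t := truncatedCone (openFacet u h k) ∪ N) ?_).trans
    ((measure_union_le _ _).trans_eq (by rw [hN, add_zero]))
  intro x hx
  by_cases hxN : x ∈ N
  · exact Or.inr hxN
  left
  have hx0 : x ≠ 0 := by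
    rintro rfl
    exact hxN (Or.inl (by simp))
  have hxk : 0 < inner ℝ x (u k) := by
    refine lt_of_le_of_ne ?_ fun h0 => hxN (Or.inl h0.symm)
    obtain ⟨j, hj⟩ := hu x hx0
    have h1 := hx.2 j
    have h2 : 0 < inner ℝ x (u j) / h j := div_pos hj (hh j)
    by_contra! hcon
    have := div_neg_of_neg_of_pos hcon (hh k)
    linarith
  rw [mem_truncatedCone_iff (w := u k) (hh k) fun x hx => hx.1]
  refine ⟨hxk, hx.1 k, ?_, fun j hj => ?_⟩
  · rw [inner_smul_left, conj_trivial]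
    field_simp
  · rw [inner_smul_left, conj_trivial]
    have hlt : inner ℝ x (u j) / h j < inner ℝ x (u k) / h k := by
      refine lt_of_le_of_ne (hx.2 j) fun heq => hxN (Or.inr ?_)
      refine Set.mem_biUnion (Finset.mem_coe.2 (Finset.mem_erase.2 ⟨hj, Finset.mem_univ j⟩)) ?_
      change inner ℝ x ((h j)⁻¹ • u j - (h k)⁻¹ • u k) = 0
      rw [inner_sub_right, inner_smul_right, inner_smul_right, inv_mul_eq_div, inv_mul_eq_div,
        heq, sub_self]
    rw [div_lt_div_iff₀ (hh j) (hh k)] at hlt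
    rw [div_mul_eq_mul_div, div_lt_iff₀ hxk]
    linarith

end Wulff

section SurfaceArea

variable {n : ℕ} {ι : Type*}
  {u : ι → Metric.sphere (0 : EuclideanSpace ℝ (Fin n)) 1} {h : ι → ℝ}

theorem isOuterUnitNormal_wulff {x : EuclideanSpace ℝ (Fin n)} {k : ι}
    (hx : inner ℝ x (u k : EuclideanSpace ℝ (Fin n)) = h k) :
    IsOuterUnitNormal (wulff (fun k => (u k : EuclideanSpace ℝ (Fin n))) h) x (u k) :=
  ⟨by simp, fun y hy => (hy k).trans_eq hx.symm⟩

theorem eq_of_isOuterUnitNormal_of_mem_openFacet [Finite ι] {x : EuclideanSpace ℝ (Fin n)} {k : ι}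
    (hx : x ∈ openFacet (fun k => (u k : EuclideanSpace ℝ (Fin n))) h k) :
    ∀ w, IsOuterUnitNormal (wulff (fun k => (u k : EuclideanSpace ℝ (Fin n))) h) x w →
      w = u k :=
  fun _ hw => eq_of_mem_openFacet_of_forall_inner_le (by simp) hx hw.1 hw.2

theorem gaussMap_of_mem_openFacet [Finite ι] {x : EuclideanSpace ℝ (Fin n)} {k : ι}
    (hx : x ∈ openFacet (fun k => (u k : EuclideanSpace ℝ (Fin n))) h k) :
    gaussMap (wulff (fun k => (u k : EuclideanSpace ℝ (Fin n))) h) x = u k :=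
  gaussMap_eq (isOuterUnitNormal_wulff hx.1) (eq_of_isOuterUnitNormal_of_mem_openFacet hx)

open scoped Classical in
/-- As the `u k` are distinct, a boundary point with two active constraints has two normals, so the
regular boundary consists of the relative interiors of the facets. -/
theorem gaussPreimage_wulff [Fintype ι] (huinj : Function.Injective u)
    (ω : Set (Metric.sphere (0 : EuclideanSpace ℝ (Fin n)) 1)) :
    gaussPreimage (wulff (fun k => (u k : EuclideanSpace ℝ (Fin n))) h) ω =
      ⋃ k ∈ Finset.univ.filter fun k => u k ∈ ω,
        openFacet (fun k => (u k : EuclideanSpace ℝ (Fin n))) h k := by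
  ext x
  simp only [Finset.mem_filter, Finset.mem_univ, true_and, Set.mem_iUnion, exists_prop]
  constructor
  · rintro ⟨⟨hxf, w, hw, hwu⟩, v, hv, hvx⟩
    have hxP : x ∈ wulff (fun k => (u k : EuclideanSpace ℝ (Fin n))) h :=
      (isClosed_wulff _ _).frontier_subset hxf
    obtain ⟨k, hk⟩ : ∃ k, inner ℝ x (u k : EuclideanSpace ℝ (Fin n)) = h k := by
      by_contra! hcon
      exact hxf.2 (mem_interior_wulff fun k => lt_of_le_of_ne (hxP k) (hcon k))
    have huk : ∀ j, inner ℝ x (u j : EuclideanSpace ℝ (Fin n)) = h j →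
        (u j : EuclideanSpace ℝ (Fin n)) = w := fun j hj => hwu _ (isOuterUnitNormal_wulff hj)
    have hg := gaussMap_eq hw hwu
    refine ⟨k, ?_, hk, fun j hj => lt_of_le_of_ne (hxP j) fun heq => hj (huinj ?_)⟩
    · have : v = u k := Subtype.ext (by rw [hvx, hg, huk k hk])
      rwa [← this]
    · exact Subtype.ext ((huk j heq).trans (huk k hk).symm)
  · rintro ⟨k, hk, hx⟩
    refine ⟨⟨⟨subset_closure (openFacet_subset_wulff _ _ _ hx), ?_⟩, u k,
      isOuterUnitNormal_wulff hx.1, eq_of_isOuterUnitNormal_of_mem_openFacet hx⟩, u k, hk,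
      (gaussMap_of_mem_openFacet hx).symm⟩
    exact not_mem_interior_of_forall_inner_le (w := u k) (by simp)
      fun y hy => (hy k).trans_eq hx.1.symm

open scoped Classical in
theorem lpSurfaceArea_wulff [Fintype ι] (p : ℝ) (huinj : Function.Injective u)
    (ω : Set (Metric.sphere (0 : EuclideanSpace ℝ (Fin n)) 1)) :
    lpSurfaceArea p (wulff (fun k => (u k : EuclideanSpace ℝ (Fin n))) h) ω =
      ∑ k ∈ Finset.univ.filter fun k => u k ∈ ω, ENNReal.ofReal (h k ^ (1 - p)) *
        Measure.euclideanHausdorffMeasure (n - 1)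
          (openFacet (fun k => (u k : EuclideanSpace ℝ (Fin n))) h k) := by
  have hdisj : ∀ i j, i ≠ j → Disjoint (openFacet (fun k => (u k : EuclideanSpace ℝ (Fin n))) h i)
      (openFacet (fun k => (u k : EuclideanSpace ℝ (Fin n))) h j) := fun i j hij =>
    Set.disjoint_left.2 fun x hi hj => (hi.2 j hij.symm).ne hj.1
  rw [lpSurfaceArea, gaussPreimage_wulff huinj,
    lintegral_biUnion_finset (fun i _ j _ hij => hdisj i j hij)
      fun k _ => measurableSet_openFacet _ _ k]
  refine Finset.sum_congr rfl fun k _ => ?_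
  rw [setLIntegral_congr_fun (g := fun _ => ENNReal.ofReal (h k ^ (1 - p)))
    (measurableSet_openFacet _ _ k), setLIntegral_const]
  intro x hx
  simp only [gaussMap_of_mem_openFacet hx]
  rw [hx.1]

end SurfaceArea

/-! ### The extremal problem -/

section Extremal

variable {E : Type*} [NormedAddCommGroup E] [InnerProductSpace ℝ E] {ι : Type*}

theorem wulff_sub_inner (u : ι → E) (h : ι → ℝ) (ξ : E) :
    wulff u (fun k => h k - inner ℝ ξ (u k)) = (fun x => x + ξ) ⁻¹' wulff u h := by
  ext x
  simp [wulff, inner_add_left, le_sub_iff_add_le]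

open scoped Pointwise in
theorem wulff_const_mul (u : ι → E) (h : ι → ℝ) {c : ℝ} (hc : 0 < c) :
    wulff u (fun k => c * h k) = c • wulff u h := by
  ext x
  rw [Set.mem_smul_set_iff_inv_smul_mem₀ hc.ne']
  refine forall_congr' fun k => ?_
  rw [inner_smul_left, conj_trivial, inv_mul_le_iff₀ hc]

open scoped Pointwise in
theorem openFacet_const_mul (u : ι → E) (h : ι → ℝ) {c : ℝ} (hc : 0 < c) (k : ι) :
    openFacet u (fun k => c * h k) k = c • openFacet u h k := by
  ext x
  rw [Set.mem_smul_set_iff_inv_smul_mem₀ hc.ne']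
  refine and_congr ?_ (forall₂_congr fun j _ => ?_)
  · rw [inner_smul_left, conj_trivial, inv_mul_eq_iff_eq_mul₀ hc.ne']
  · rw [inner_smul_left, conj_trivial, inv_mul_lt_iff₀ hc]

/-- The tangent-line inequality for the concave function `t ↦ t ^ p`. -/
theorem rpow_le_rpow_add_mul_sub {p s t : ℝ} (hp0 : 0 ≤ p) (hp1 : p ≤ 1) (hs : 0 < s)
    (ht : 0 ≤ t) : t ^ p ≤ s ^ p + p * s ^ (p - 1) * (t - s) := by
  have h1 : (1 + (t / s - 1)) ^ p ≤ 1 + p * (t / s - 1) :=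
    rpow_one_add_le_one_add_mul_self (by linarith [div_nonneg ht hs.le]) hp0 hp1
  rw [add_sub_cancel, Real.div_rpow ht hs.le, div_le_iff₀ (Real.rpow_pos_of_pos hs p)] at h1
  rw [Real.rpow_sub_one hs.ne']
  calc t ^ p ≤ (1 + p * (t / s - 1)) * s ^ p := h1
    _ = s ^ p + p * (s ^ p / s) * (t - s) := by
      field_simp

theorem exists_one_le_volume_wulff [Nontrivial E] [FiniteDimensional ℝ E] [MeasurableSpace E]
    [BorelSpace E] {u : ι → E} (hu1 : ∀ k, ‖u k‖ = 1) :
    ∃ h : ι → ℝ, 1 ≤ volume (wulff u h) := by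
  have htend : Filter.Tendsto (fun m : ℕ => volume (Metric.ball (0 : E) m)) Filter.atTop
      (nhds (volume (⋃ m : ℕ, Metric.ball (0 : E) m))) :=
    tendsto_measure_iUnion_atTop fun i j hij => Metric.ball_subset_ball (by exact_mod_cast hij)
  rw [Metric.iUnion_ball_nat, measure_univ_of_isAddLeftInvariant] at htend
  obtain ⟨m, hm⟩ := (htend.eventually_const_lt ENNReal.one_lt_top).exists
  refine ⟨fun _ => m, hm.le.trans (measure_mono fun x hx k => ?_)⟩
  have h1 : inner ℝ x (u k) ≤ ‖x‖ := by simpa [hu1 k] using real_inner_le_norm x (u k)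
  have h2 : ‖x‖ < m := by simpa using hx
  exact h1.trans h2.le

variable [Fintype ι]

/-- The functional `∑ α k * h k ^ p` on families of heights. -/
noncomputable def powerSum (α : ι → ℝ) (p : ℝ) (h : ι → ℝ) : ℝ :=
  ∑ k, α k * h k ^ p

theorem continuous_powerSum (α : ι → ℝ) {p : ℝ} (hp : 0 < p) : Continuous (powerSum α p) :=
  continuous_finsetSum _ fun k _ =>
    continuous_const.mul ((continuous_apply k).rpow_const fun _ => Or.inr hp.le)

theorem powerSum_pos [Nonempty ι] {α : ι → ℝ} (hα : ∀ k, 0 < α k) (p : ℝ) {h : ι → ℝ}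
    (hh : ∀ k, 0 < h k) : 0 < powerSum α p h :=
  Finset.sum_pos (fun k _ => mul_pos (hα k) (Real.rpow_pos_of_pos (hh k) p)) Finset.univ_nonempty

variable [MeasurableSpace E]

/-- The nonnegative heights for which `wulff u h` has volume at least one and for which the origin
is the best choice of centre: no translation of the origin to an interior point increases
`powerSum α p`. -/
def centeredHeights [FiniteDimensional ℝ E] [BorelSpace E] (α : ι → ℝ) (p : ℝ) (u : ι → E) :
    Set (ι → ℝ) :=
  {h | (∀ k, 0 ≤ h k) ∧ 1 ≤ volume (wulff u h) ∧ ∀ ξ : E, (∀ k, inner ℝ ξ (u k) < h k) →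
    powerSum α p (fun k => h k - inner ℝ ξ (u k)) ≤ powerSum α p h}

variable [FiniteDimensional ℝ E] [BorelSpace E]

theorem volume_inner_eq_const_eq_zero {w : E} (hw : w ≠ 0) (c : ℝ) :
    volume {x : E | inner ℝ x w = c} = 0 := by
  have h : {x : E | inner ℝ x w = c} =
      (fun x => x + -((c / ‖w‖ ^ 2) • w)) ⁻¹' {x : E | inner ℝ x w = 0} := by
    ext x
    have : ‖w‖ ^ 2 ≠ 0 := by simpa using hw
    simp only [Set.mem_ofPred_eq, Set.mem_preimage, inner_add_left, inner_neg_left, inner_smul_left,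
      real_inner_self_eq_norm_sq, conj_trivial]
    rw [div_mul_cancel₀ _ this, ← sub_eq_add_neg, sub_eq_zero]
  rw [h, measure_preimage_add_right, volume_inner_eq_zero hw]

theorem exists_forall_inner_lt_of_volume_wulff_ne_zero {u : ι → E} (hu1 : ∀ k, ‖u k‖ = 1)
    {h : ι → ℝ} (hV : volume (wulff u h) ≠ 0) : ∃ z : E, ∀ k, inner ℝ z (u k) < h k := by
  by_contra! hcon
  refine hV (measure_mono_null (t := ⋃ k, {x | inner ℝ x (u k) = h k}) (fun x hx => ?_)
    (measure_iUnion_null fun k => volume_inner_eq_const_eq_zero ?_ _))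
  · obtain ⟨k, hk⟩ := hcon x
    exact Set.mem_iUnion.2 ⟨k, le_antisymm (hx k) hk⟩
  · intro h0
    have := hu1 k
    simp [h0] at this

/-- The volume of `wulff u h` is an upper semicontinuous function of `h`. -/
theorem isClosed_setOf_le_volume_wulff [Nontrivial E] {u : ι → E}
    (hu : ∀ v : E, v ≠ 0 → ∃ k, 0 < inner ℝ v (u k)) (a : ℝ≥0∞) :
    IsClosed {h : ι → ℝ | a ≤ volume (wulff u h)} := by
  refine IsSeqClosed.isClosed fun g h hg hlim => ?_
  have hinter : wulff u h = ⋂ m : ℕ, wulff u fun k => h k + 1 / ((m : ℝ) + 1) := by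
    ext x
    simp only [Set.mem_iInter]
    refine ⟨fun hx m k => (hx k).trans (le_add_of_nonneg_right (by positivity)), fun hx k => ?_⟩
    have : Filter.Tendsto (fun m : ℕ => h k + 1 / ((m : ℝ) + 1)) Filter.atTop (nhds (h k + 0)) :=
      tendsto_const_nhds.add tendsto_one_div_add_atTop_nhds_zero_nat
    rw [add_zero] at this
    exact ge_of_tendsto' this fun m => hx m k
  have htend : Filter.Tendsto (fun m : ℕ => volume (wulff u fun k => h k + 1 / ((m : ℝ) + 1)))
      Filter.atTop (nhds (volume (wulff u h))) := by
    rw [hinter]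
    refine tendsto_measure_iInter_atTop
      (fun m => (isClosed_wulff _ _).measurableSet.nullMeasurableSet) ?_
      ⟨0, (isCompact_wulff hu _).measure_lt_top.ne⟩
    intro m m' hm x hx k
    have hm' : (m : ℝ) ≤ m' := by exact_mod_cast hm
    refine (hx k).trans ?_
    change h k + 1 / ((m' : ℝ) + 1) ≤ h k + 1 / ((m : ℝ) + 1)
    gcongr
  refine ge_of_tendsto' htend fun m => ?_
  have hev : ∀ᶠ i in Filter.atTop, ∀ k, g i k < h k + 1 / ((m : ℝ) + 1) :=
    Filter.eventually_all.2 fun k => ((tendsto_pi_nhds.1 hlim) k).eventually_lt_const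
      (lt_add_of_pos_right _ (by positivity))
  obtain ⟨i, hi⟩ := hev.exists
  exact (hg i).trans (measure_mono fun x hx k => (hx k).trans (hi k).le)

theorem isClosed_centeredHeights [Nontrivial E] {u : ι → E}
    (hu : ∀ v : E, v ≠ 0 → ∃ k, 0 < inner ℝ v (u k)) (α : ι → ℝ) {p : ℝ} (hp : 0 < p) :
    IsClosed (centeredHeights α p u) := by
  have heq : centeredHeights α p u = (⋂ k, {h : ι → ℝ | 0 ≤ h k}) ∩
      ({h | 1 ≤ volume (wulff u h)} ∩ ⋂ ξ : E, ((⋃ k, {h : ι → ℝ | h k ≤ inner ℝ ξ (u k)}) ∪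
        {h | powerSum α p (fun k => h k - inner ℝ ξ (u k)) ≤ powerSum α p h})) := by
    ext h
    simp only [centeredHeights, Set.mem_ofPred_eq, Set.mem_inter_iff, Set.mem_iInter, Set.mem_union,
      Set.mem_iUnion]
    refine and_congr_right fun _ => and_congr_right fun _ => forall_congr' fun ξ => ?_
    rw [← not_forall_not]
    simp only [not_le]
    exact imp_iff_not_or
  rw [heq]
  refine (isClosed_iInter fun k => isClosed_le continuous_const (continuous_apply k)).inter
    ((isClosed_setOf_le_volume_wulff hu 1).inter (isClosed_iInter fun ξ => ?_))
  refine (isClosed_iUnion_of_finite fun k => isClosed_le (continuous_apply k)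
    continuous_const).union (isClosed_le ((continuous_powerSum α hp).comp (by fun_prop))
      (continuous_powerSum α hp))

/-- Every family of heights of volume at least one becomes centered after a translation: move the
origin to a maximum point of `powerSum α p` on the compact set `wulff u h`. -/
theorem exists_sub_inner_mem_centeredHeights [Nontrivial E] {u : ι → E}
    (hu : ∀ v : E, v ≠ 0 → ∃ k, 0 < inner ℝ v (u k)) (α : ι → ℝ) {p : ℝ} (hp : 0 < p) {h : ι → ℝ}
    (hV : 1 ≤ volume (wulff u h)) :
    ∃ ξ : E, (fun k => h k - inner ℝ ξ (u k)) ∈ centeredHeights α p u := by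
  have hne : (wulff u h).Nonempty := nonempty_of_measure_ne_zero (zero_lt_one.trans_le hV).ne'
  have hcont : Continuous fun ξ : E => powerSum α p fun k => h k - inner ℝ ξ (u k) :=
    (continuous_powerSum α hp).comp (by fun_prop)
  obtain ⟨ξ, hξ, hmax⟩ := (isCompact_wulff hu h).exists_isMaxOn hne hcont.continuousOn
  refine ⟨ξ, fun k => sub_nonneg.2 (hξ k), ?_, fun η hη => ?_⟩
  · rwa [wulff_sub_inner, measure_preimage_add_right]
  · have hmem : ξ + η ∈ wulff u h := fun k => by
      rw [inner_add_left]
      linarith [hη k]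
    have := isMaxOn_iff.1 hmax _ hmem
    simpa only [inner_add_left, sub_sub] using this

theorem exists_isMinOn_powerSum_centeredHeights [Nontrivial E] {u : ι → E} (hu1 : ∀ k, ‖u k‖ = 1)
    (hu : ∀ v : E, v ≠ 0 → ∃ k, 0 < inner ℝ v (u k)) {α : ι → ℝ} (hα : ∀ k, 0 < α k) {p : ℝ}
    (hp : 0 < p) :
    ∃ h ∈ centeredHeights α p u, ∀ g ∈ centeredHeights α p u, powerSum α p h ≤ powerSum α p g := by
  obtain ⟨h₁, hh₁⟩ := exists_one_le_volume_wulff hu1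
  obtain ⟨ξ, hξ⟩ := exists_sub_inner_mem_centeredHeights hu α hp hh₁
  set h₀ : ι → ℝ := fun k => h₁ k - inner ℝ ξ (u k)
  -- a sublevel set of `powerSum α p` is bounded because every summand is nonnegative
  set S := centeredHeights α p u ∩ {g | powerSum α p g ≤ powerSum α p h₀} with hS
  have hScl : IsClosed S := (isClosed_centeredHeights hu α hp).inter
    (isClosed_le (continuous_powerSum α hp) continuous_const)
  have hSsub : S ⊆ Set.Icc 0 fun k => (powerSum α p h₀ / α k) ^ p⁻¹ := by
    rintro g ⟨hg, hle⟩
    refine ⟨fun k => hg.1 k, fun k => ?_⟩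
    rw [Real.le_rpow_inv_iff_of_pos (hg.1 k) ?_ hp, le_div_iff₀ (hα k), mul_comm]
    · exact (Finset.single_le_sum (f := fun k => α k * g k ^ p)
        (fun j _ => mul_nonneg (hα j).le (Real.rpow_nonneg (hg.1 j) p))
        (Finset.mem_univ k)).trans hle
    · exact div_nonneg (Finset.sum_nonneg fun j _ =>
        mul_nonneg (hα j).le (Real.rpow_nonneg (hξ.1 j) p)) (hα k).le
  have hScomp : IsCompact S := isCompact_Icc.of_isClosed_subset hScl hSsub
  obtain ⟨h, hhS, hmin⟩ := hScomp.exists_isMinOn ⟨h₀, hξ, le_refl (powerSum α p h₀)⟩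
    (continuous_powerSum α hp).continuousOn
  refine ⟨h, hhS.1, fun g hg => ?_⟩
  rcases le_total (powerSum α p g) (powerSum α p h₀) with hle | hle
  · exact isMinOn_iff.1 hmin g ⟨hg, hle⟩
  · exact hhS.2.trans hle

/-- The origin is interior for centered heights. Otherwise moving it by `t` towards an interior
point would gain at least a multiple of `t ^ p` and lose at most a multiple of `t`. -/
theorem pos_of_mem_centeredHeights {u : ι → E} (hu1 : ∀ k, ‖u k‖ = 1) {α : ι → ℝ}
    (hα : ∀ k, 0 < α k) {p : ℝ} (hp0 : 0 < p) (hp1 : p < 1) {h : ι → ℝ}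
    (hh : h ∈ centeredHeights α p u) (k : ι) : 0 < h k := by
  obtain ⟨hnn, hV, hmax⟩ := hh
  refine lt_of_le_of_ne (hnn k) fun hk => ?_
  obtain ⟨z, hz⟩ := exists_forall_inner_lt_of_volume_wulff_ne_zero hu1
    (zero_lt_one.trans_le hV).ne'
  set B := α k * (h k - inner ℝ z (u k)) ^ p with hB
  have hB0 : 0 < B := mul_pos (hα k) (Real.rpow_pos_of_pos (sub_pos.2 (hz k)) p)
  have hbound : ∀ t : ℝ, 0 < t → t < 1 → B ≤ t ^ (1 - p) * powerSum α p h := by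
    intro t ht0 ht1
    have hstrict : ∀ j, inner ℝ (t • z) (u j) < h j := fun j => by
      rw [inner_smul_left, conj_trivial]
      nlinarith [hz j, hnn j]
    have hsplit : ∀ j, h j - inner ℝ (t • z) (u j) =
        (1 - t) * h j + t * (h j - inner ℝ z (u j)) := fun j => by
      rw [inner_smul_left, conj_trivial]
      ring
    have hterm : ∀ j, (1 - t) * (α j * h j ^ p) ≤ α j * (h j - inner ℝ (t • z) (u j)) ^ p := by
      intro j
      have h1 : (1 - t) * h j ^ p ≤ ((1 - t) * h j) ^ p := by
        rw [Real.mul_rpow (by linarith) (hnn j)]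
        refine mul_le_mul_of_nonneg_right ?_ (Real.rpow_nonneg (hnn j) p)
        simpa using Real.rpow_le_rpow_of_exponent_ge (by linarith : 0 < 1 - t) (by linarith) hp1.le
      have h2 : ((1 - t) * h j) ^ p ≤ (h j - inner ℝ (t • z) (u j)) ^ p := by
        refine Real.rpow_le_rpow (mul_nonneg (by linarith) (hnn j)) ?_ hp0.le
        rw [hsplit]
        nlinarith [hz j]
      nlinarith [hα j]
    have htermk : (1 - t) * (α k * h k ^ p) + t ^ p * B =
        α k * (h k - inner ℝ (t • z) (u k)) ^ p := by
      rw [hsplit, hB, ← hk, Real.zero_rpow hp0.ne', mul_zero, mul_zero, zero_add, zero_add,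
        Real.mul_rpow ht0.le (by simpa [← hk] using (hz k).le)]
      ring
    have hsum : (1 - t) * powerSum α p h + t ^ p * B ≤
        powerSum α p fun j => h j - inner ℝ (t • z) (u j) := by
      classical
      rw [powerSum, powerSum, ← Finset.add_sum_erase _ _ (Finset.mem_univ k),
        ← Finset.add_sum_erase _ _ (Finset.mem_univ k), ← htermk, mul_add, Finset.mul_sum]
      have := Finset.sum_le_sum fun j (_ : j ∈ Finset.univ.erase k) => hterm j
      linarith
    have h3 := hsum.trans (hmax _ hstrict)
    have h4 : t ^ p * B ≤ t ^ p * (t ^ (1 - p) * powerSum α p h) := by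
      rw [← mul_assoc (t ^ p) (t ^ (1 - p)), ← Real.rpow_add ht0, add_sub_cancel, Real.rpow_one]
      linarith
    exact le_of_mul_le_mul_left h4 (Real.rpow_pos_of_pos ht0 p)
  -- the bound fails for small `t` because `p < 1`
  have hlim : Filter.Tendsto (fun t : ℝ => t ^ (1 - p) * powerSum α p h)
      (nhdsWithin 0 (Set.Ioi 0)) (nhds 0) := by
    have hc : Continuous fun t : ℝ => t ^ (1 - p) * powerSum α p h :=
      (continuous_id.rpow_const fun _ => Or.inr (by linarith)).mul continuous_const
    have := hc.tendsto 0
    rw [Real.zero_rpow (by linarith), zero_mul] at this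
    exact this.mono_left nhdsWithin_le_nhds
  refine hB0.not_ge (ge_of_tendsto hlim ?_)
  filter_upwards [Ioo_mem_nhdsGT (zero_lt_one (α := ℝ))] with t ht
  exact hbound t ht.1 ht.2

/-- The first-order condition for the origin to be the best centre. -/
theorem sum_mul_rpow_mul_inner_eq_zero {u : ι → E} {α : ι → ℝ} {p : ℝ} (hp0 : 0 < p) {h : ι → ℝ}
    (hh : h ∈ centeredHeights α p u) (hpos : ∀ k, 0 < h k) (v : E) :
    ∑ k, α k * h k ^ (p - 1) * inner ℝ v (u k) = 0 := by
  have hder : HasDerivAt (fun ε : ℝ => powerSum α p fun k => h k - inner ℝ (ε • v) (u k))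
      (∑ k, α k * (-inner ℝ v (u k) * p * h k ^ (p - 1))) 0 := by
    unfold powerSum
    refine HasDerivAt.fun_sum fun k _ => ?_
    have h1 : HasDerivAt (fun ε : ℝ => h k - inner ℝ (ε • v) (u k)) (-inner ℝ v (u k)) 0 := by
      simp only [inner_smul_left, conj_trivial]
      simpa using ((hasDerivAt_id (0 : ℝ)).mul_const (inner ℝ v (u k))).const_sub (h k)
    have h2 := (h1.rpow_const (p := p) (Or.inl (by simpa using (hpos k).ne'))).const_mul (α k)
    simpa using h2
  have hloc : IsLocalMax (fun ε : ℝ => powerSum α p fun k => h k - inner ℝ (ε • v) (u k)) 0 := by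
    have hev : ∀ᶠ ε : ℝ in nhds 0, ∀ k, inner ℝ (ε • v) (u k) < h k := by
      refine Filter.eventually_all.2 fun k => ?_
      have hc : Continuous fun ε : ℝ => inner ℝ (ε • v) (u k) := by fun_prop
      exact (hc.tendsto 0).eventually_lt_const (by simpa using hpos k)
    filter_upwards [hev] with ε hε
    simpa using hh.2.2 _ hε
  have h0 := hloc.hasDerivAt_eq_zero hder
  have h1 : ∑ k, α k * (-inner ℝ v (u k) * p * h k ^ (p - 1)) =
      -p * ∑ k, α k * h k ^ (p - 1) * inner ℝ v (u k) := by
    rw [Finset.mul_sum]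
    exact Finset.sum_congr rfl fun k _ => by ring
  rw [h1] at h0
  exact (mul_eq_zero.1 h0).resolve_left (neg_ne_zero.2 hp0.ne')

/-- There are positive heights `h` that minimize the linear functional with coefficients
`α k * h k ^ (p - 1)` among all heights of volume at least one. They are the minimizers of the
best-centre value of `powerSum α p`: by concavity the tangent functional at `h` bounds
`powerSum α p` from above, and by the first-order condition it does not see translations. -/
theorem exists_forall_sum_mul_le [Nontrivial E] {u : ι → E} (hu1 : ∀ k, ‖u k‖ = 1)
    (hu : ∀ v : E, v ≠ 0 → ∃ k, 0 < inner ℝ v (u k)) {α : ι → ℝ} (hα : ∀ k, 0 < α k) {p : ℝ}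
    (hp0 : 0 < p) (hp1 : p < 1) :
    ∃ h : ι → ℝ, (∀ k, 0 < h k) ∧ 1 ≤ volume (wulff u h) ∧
      ∀ g : ι → ℝ, 1 ≤ volume (wulff u g) →
        ∑ k, α k * h k ^ (p - 1) * h k ≤ ∑ k, α k * h k ^ (p - 1) * g k := by
  obtain ⟨h, hh, hmin⟩ := exists_isMinOn_powerSum_centeredHeights hu1 hu hα hp0
  have hpos := pos_of_mem_centeredHeights hu1 hα hp0 hp1 hh
  refine ⟨h, hpos, hh.2.1, fun g hg => ?_⟩
  obtain ⟨ξ, hξ⟩ := exists_sub_inner_mem_centeredHeights hu α hp0 hg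
  have hle := hmin _ hξ
  have htan : powerSum α p (fun k => g k - inner ℝ ξ (u k)) ≤ powerSum α p h +
      p * ∑ k, α k * h k ^ (p - 1) * (g k - inner ℝ ξ (u k) - h k) := by
    rw [powerSum, powerSum, Finset.mul_sum, ← Finset.sum_add_distrib]
    refine Finset.sum_le_sum fun k _ => ?_
    have := mul_le_mul_of_nonneg_left
      (rpow_le_rpow_add_mul_sub hp0.le hp1.le (hpos k) (hξ.1 k)) (hα k).le
    refine this.trans_eq ?_
    ring
  have hzero := sum_mul_rpow_mul_inner_eq_zero hp0 hh hpos ξ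
  have hnn : 0 ≤ p * ∑ k, α k * h k ^ (p - 1) * (g k - inner ℝ ξ (u k) - h k) := by linarith
  have hnn' := nonneg_of_mul_nonneg_right hnn hp0
  simp only [mul_sub, Finset.sum_sub_distrib, hzero] at hnn'
  linarith

end Extremal

/-! ### First variation of the volume -/

section FirstVariation

variable {E : Type*} [NormedAddCommGroup E] [InnerProductSpace ℝ E] {ι : Type*}

/-- The points of `wulff u h` at which the `k`-th of the functions `x ↦ (x · u j) / h j` is
nonnegative and within a factor `1 - t` of the largest one. These sets decrease to a subset of
the `k`-th sector as `t` decreases to `0`. -/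
def nearSector (u : ι → E) (h : ι → ℝ) (k : ι) (t : ℝ) : Set E :=
  {x | x ∈ wulff u h ∧ 0 ≤ inner ℝ x (u k) ∧
    ∀ j, (1 - t) * (inner ℝ x (u j) / h j) ≤ inner ℝ x (u k) / h k}

theorem isClosed_nearSector (u : ι → E) (h : ι → ℝ) (k : ι) (t : ℝ) :
    IsClosed (nearSector u h k t) := by
  have : nearSector u h k t = wulff u h ∩ ({x | 0 ≤ inner ℝ x (u k)} ∩
      ⋂ j, {x | (1 - t) * (inner ℝ x (u j) / h j) ≤ inner ℝ x (u k) / h k}) := by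
    ext x
    exact ⟨fun ⟨h1, h2, h3⟩ => ⟨h1, h2, Set.mem_iInter.2 h3⟩,
      fun ⟨h1, h2, h3⟩ => ⟨h1, h2, fun j => Set.mem_iInter.1 h3 j⟩⟩
  rw [this]
  refine (isClosed_wulff u h).inter ((isClosed_le continuous_const (by fun_prop)).inter
    (isClosed_iInter fun j => isClosed_le (by fun_prop) (by fun_prop)))

theorem nearSector_mono (u : ι → E) {h : ι → ℝ} (hh : ∀ k, 0 < h k) (k : ι) {s t : ℝ}
    (hst : s ≤ t) (ht : t ≤ 1) : nearSector u h k s ⊆ nearSector u h k t := by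
  rintro x ⟨hx, hk, hj⟩
  refine ⟨hx, hk, fun j => ?_⟩
  have hk' : 0 ≤ inner ℝ x (u k) / h k := div_nonneg hk (hh k).le
  rcases le_total 0 (inner ℝ x (u j) / h j) with h0 | h0
  · exact (mul_le_mul_of_nonneg_right (by linarith) h0).trans (hj j)
  · exact (mul_nonpos_of_nonneg_of_nonpos (by linarith) h0).trans hk'

open scoped Pointwise in
theorem smul_nearSector_subset (u : ι → E) {h : ι → ℝ} (hh : ∀ k, 0 < h k) (k : ι) (t : ℝ) {c : ℝ}
    (hc0 : 0 ≤ c) (hc1 : c ≤ 1) : c • nearSector u h k t ⊆ nearSector u h k t := by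
  rintro _ ⟨x, ⟨hx, hk, hj⟩, rfl⟩
  refine ⟨fun j => ?_, ?_, fun j => ?_⟩ <;> simp only [inner_smul_left, conj_trivial]
  · nlinarith [hx j, hh j]
  · exact mul_nonneg hc0 hk
  · have := mul_le_mul_of_nonneg_left (hj j) hc0
    rw [mul_div_assoc, mul_div_assoc]
    linarith

open scoped Pointwise in
theorem wulff_diff_wulff_update_subset [DecidableEq ι] {u : ι → E} {h : ι → ℝ}
    (hh : ∀ k, 0 < h k) (k : ι) {t : ℝ} (ht1 : t < 1) :
    wulff u h \ wulff u (Function.update h k ((1 - t) * h k)) ⊆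
      nearSector u h k t \ (1 - t) • nearSector u h k t := by
  rintro x ⟨hx, hxt⟩
  have hlt : (1 - t) * h k < inner ℝ x (u k) := by
    by_contra! hcon
    refine hxt fun j => ?_
    rcases eq_or_ne j k with rfl | hj
    · rwa [Function.update_self]
    · rw [Function.update_of_ne hj]
      exact hx j
  have hhk := hh k
  refine ⟨⟨hx, (mul_pos (by linarith) hhk).le.trans hlt.le, fun j => ?_⟩, ?_⟩
  · have h1 : inner ℝ x (u j) / h j ≤ 1 := (div_le_one (hh j)).2 (hx j)
    have h2 : (1 - t) ≤ inner ℝ x (u k) / h k := (le_div_iff₀ hhk).2 hlt.le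
    nlinarith
  · rintro ⟨y, ⟨hy, -⟩, rfl⟩
    simp only [inner_smul_left, conj_trivial] at hlt
    have := hy k
    nlinarith

variable [FiniteDimensional ℝ E] [MeasurableSpace E] [BorelSpace E]

open scoped Pointwise in
theorem volume_wulff_const_mul (u : ι → E) (h : ι → ℝ) {c : ℝ} (hc : 0 < c) :
    volume (wulff u fun k => c * h k) =
      ENNReal.ofReal (c ^ Module.finrank ℝ E) * volume (wulff u h) := by
  rw [wulff_const_mul u h hc, Measure.addHaar_smul, abs_of_pos (pow_pos hc _)]

open scoped Pointwise in
/-- Lowering one of the heights by a factor `1 - t` costs at most a shell of a near-sector. -/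
theorem volume_wulff_le_add [Fintype ι] [DecidableEq ι] [Nontrivial E] {u : ι → E}
    (hu : ∀ v : E, v ≠ 0 → ∃ k, 0 < inner ℝ v (u k)) {h : ι → ℝ} (hh : ∀ k, 0 < h k) (k : ι)
    {t : ℝ} (ht0 : 0 < t) (ht1 : t < 1) :
    volume.real (wulff u h) ≤
      volume.real (wulff u (Function.update h k ((1 - t) * h k))) +
        (1 - (1 - t) ^ Module.finrank ℝ E) * volume.real (nearSector u h k t) := by
  have hfin : volume (nearSector u h k t) ≠ ⊤ :=
    measure_ne_top_of_subset (fun x hx => hx.1) (isCompact_wulff hu h).measure_lt_top.ne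
  have hfin' : volume (nearSector u h k t \ ((1 - t) • nearSector u h k t)) ≠ ⊤ :=
    measure_ne_top_of_subset Set.sdiff_subset hfin
  have hm : MeasurableSet ((1 - t) • nearSector u h k t) :=
    (isClosed_nearSector u h k t).measurableSet.const_smul₀ _
  have hdiff : volume.real (nearSector u h k t \ ((1 - t) • nearSector u h k t)) =
      (1 - (1 - t) ^ Module.finrank ℝ E) * volume.real (nearSector u h k t) := by
    rw [measureReal_sdiff (smul_nearSector_subset u hh k t (by linarith) (by linarith)) hm hfin,
      measureReal_def, measureReal_def, Measure.addHaar_smul, ENNReal.toReal_mul,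
      ENNReal.toReal_ofReal (abs_nonneg _), abs_of_pos (pow_pos (by linarith) _)]
    ring
  rw [← hdiff]
  refine (measureReal_mono (fun x hx => ?_) (measure_union_ne_top
    (isCompact_wulff hu _).measure_lt_top.ne hfin')).trans (measureReal_union_le _ _)
  by_cases hxt : x ∈ wulff u (Function.update h k ((1 - t) * h k))
  · exact Or.inl hxt
  · exact Or.inr (wulff_diff_wulff_update_subset hh k ht1 ⟨hx, hxt⟩)

/-- The scale-invariant form of minimality of a linear functional under a volume constraint. -/
theorem volume_wulff_mul_pow_le [Fintype ι] [Nontrivial E] {u : ι → E}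
    (hu : ∀ v : E, v ≠ 0 → ∃ k, 0 < inner ℝ v (u k)) {L h : ι → ℝ}
    (hLh : 0 ≤ ∑ k, L k * h k)
    (hmin : ∀ g : ι → ℝ, 1 ≤ volume (wulff u g) → ∑ k, L k * h k ≤ ∑ k, L k * g k) {g : ι → ℝ}
    (hg : 0 ≤ ∑ k, L k * g k) :
    volume.real (wulff u g) * (∑ k, L k * h k) ^ Module.finrank ℝ E ≤
      (∑ k, L k * g k) ^ Module.finrank ℝ E := by
  have hd : Module.finrank ℝ E ≠ 0 := Module.finrank_pos.ne'
  rcases (measureReal_nonneg (μ := volume) (s := wulff u g)).eq_or_lt with h0 | hpos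
  · rw [← h0, zero_mul]
    exact pow_nonneg hg _
  set V := volume.real (wulff u g) with hV
  set c := (V⁻¹) ^ ((Module.finrank ℝ E : ℝ)⁻¹) with hc
  have hc0 : 0 < c := Real.rpow_pos_of_pos (inv_pos.2 hpos) _
  have hcd : c ^ Module.finrank ℝ E = V⁻¹ := Real.rpow_inv_natCast_pow (inv_pos.2 hpos).le hd
  have hvol : volume (wulff u fun k => c * g k) = 1 := by
    rw [volume_wulff_const_mul u g hc0, hcd,
      ← ENNReal.ofReal_toReal (isCompact_wulff hu g).measure_lt_top.ne, ← measureReal_def,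
      ← ENNReal.ofReal_mul (inv_pos.2 hpos).le, inv_mul_cancel₀ hpos.ne', ENNReal.ofReal_one]
  have h1 := hmin _ hvol.ge
  have h2 : ∑ k, L k * (c * g k) = c * ∑ k, L k * g k := by
    rw [Finset.mul_sum]
    exact Finset.sum_congr rfl fun k _ => by ring
  rw [h2] at h1
  have h3 := pow_le_pow_left₀ hLh h1 (Module.finrank ℝ E)
  rw [mul_pow, hcd] at h3
  calc _ ≤ V * (V⁻¹ * (∑ k, L k * g k) ^ Module.finrank ℝ E) :=
        mul_le_mul_of_nonneg_left h3 hpos.le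
    _ = _ := by rw [← mul_assoc, mul_inv_cancel₀ hpos.ne', one_mul]

theorem tendsto_one_sub_one_sub_mul_pow_div (l : ℝ) (d : ℕ) :
    Filter.Tendsto (fun t : ℝ => (1 - (1 - t * l) ^ d) / t) (nhdsWithin 0 {0}ᶜ) (nhds (d * l)) := by
  have hder : HasDerivAt (fun t : ℝ => 1 - (1 - t * l) ^ d) (d * l) 0 := by
    have := (((hasDerivAt_id (0 : ℝ)).mul_const l).const_sub 1).fun_pow d |>.const_sub 1
    simpa using this
  have := hder.tendsto_slope
  refine this.congr fun t => ?_
  rw [slope_def_field]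
  simp

/-- The cone over the `k`-th facet of a minimizer has at least its due share of the volume: this is
the first-order condition for lowering the `k`-th height. -/
theorem le_volume_sector [Fintype ι] [Nontrivial E] {u : ι → E}
    (hu : ∀ v : E, v ≠ 0 → ∃ k, 0 < inner ℝ v (u k)) {L h : ι → ℝ} (hL : ∀ k, 0 < L k)
    (hh : ∀ k, 0 < h k) (hV : 1 ≤ volume (wulff u h))
    (hmin : ∀ g : ι → ℝ, 1 ≤ volume (wulff u g) → ∑ k, L k * h k ≤ ∑ k, L k * g k) (k : ι) :
    L k * h k / ∑ j, L j * h j ≤ volume.real (sector u h k) := by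
  classical
  have hd : (0 : ℝ) < Module.finrank ℝ E := by exact_mod_cast Module.finrank_pos (R := ℝ) (M := E)
  have hS : 0 < ∑ j, L j * h j :=
    Finset.sum_pos (fun j _ => mul_pos (hL j) (hh j)) ⟨k, Finset.mem_univ k⟩
  set S := ∑ j, L j * h j with hSdef
  set l := L k * h k / S with hl
  have hfin : volume (wulff u h) ≠ ⊤ := (isCompact_wulff hu h).measure_lt_top.ne
  have hV' : 1 ≤ volume.real (wulff u h) := by
    rw [measureReal_def]
    exact (ENNReal.toReal_mono hfin hV).trans_eq' (by simp)
  have key : ∀ t : ℝ, 0 < t → t < 1 → (1 - (1 - t * l) ^ Module.finrank ℝ E) / t ≤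
      Module.finrank ℝ E * volume.real (nearSector u h k t) := by
    intro t ht0 ht1
    have hupd : ∑ j, L j * Function.update h k ((1 - t) * h k) j = S * (1 - t * l) := by
      have h1 : ∀ j, L j * Function.update h k ((1 - t) * h k) j =
          L j * h j - if j = k then t * (L k * h k) else 0 := by
        intro j
        rcases eq_or_ne j k with rfl | hj
        · simp only [Function.update_self, if_true]
          ring
        · simp [hj]
      simp only [h1, Finset.sum_sub_distrib, Finset.sum_ite_eq', Finset.mem_univ, if_true]
      rw [← hSdef, hl]
      field_simp
    have hpos : 0 ≤ ∑ j, L j * Function.update h k ((1 - t) * h k) j := by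
      refine Finset.sum_nonneg fun j _ => mul_nonneg (hL j).le ?_
      rcases eq_or_ne j k with rfl | hj
      · rw [Function.update_self]
        exact mul_nonneg (by linarith) (hh j).le
      · rw [Function.update_of_ne hj]
        exact (hh j).le
    have h2 := volume_wulff_mul_pow_le hu hS.le hmin hpos
    rw [hupd, mul_pow, mul_comm (S ^ _)] at h2
    have h3 := le_of_mul_le_mul_right h2 (pow_pos hS _)
    have h4 := volume_wulff_le_add hu hh k ht0 ht1
    have h5 : 1 - (1 - t) ^ Module.finrank ℝ E ≤ Module.finrank ℝ E * t := by
      have := one_add_mul_le_pow (show (-2 : ℝ) ≤ -t by linarith) (Module.finrank ℝ E)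
      rw [← sub_eq_add_neg] at this
      linarith
    have h6 := mul_le_mul_of_nonneg_right h5
      (measureReal_nonneg (μ := volume) (s := nearSector u h k t))
    rw [div_le_iff₀ ht0]
    linarith
  -- let `t` run through `1 / (m + 2)`
  have ht0 : ∀ m : ℕ, (0 : ℝ) < 1 / ((m : ℝ) + 2) := fun m => by positivity
  have ht1 : ∀ m : ℕ, 1 / ((m : ℝ) + 2) < 1 := fun m => by
    rw [div_lt_one (by positivity)]
    linarith [Nat.cast_nonneg (α := ℝ) m]
  have htlim : Filter.Tendsto (fun m : ℕ => 1 / ((m : ℝ) + 2)) Filter.atTop (nhds 0) := by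
    have := (tendsto_one_div_add_atTop_nhds_zero_nat (𝕜 := ℝ)).comp (Filter.tendsto_add_atTop_nat 1)
    refine this.congr fun m => ?_
    simp only [Function.comp_apply, Nat.cast_add, Nat.cast_one, add_assoc]
    norm_num
  have hlim1 := (tendsto_one_sub_one_sub_mul_pow_div l (Module.finrank ℝ E)).comp
    (tendsto_nhdsWithin_iff.2 ⟨htlim, Filter.Eventually.of_forall fun m => (ht0 m).ne'⟩)
  have hlim2 : Filter.Tendsto (fun m : ℕ => volume.real (nearSector u h k (1 / ((m : ℝ) + 2))))
      Filter.atTop (nhds (volume.real (⋂ m : ℕ, nearSector u h k (1 / ((m : ℝ) + 2))))) := by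
    refine (ENNReal.tendsto_toReal ?_).comp (tendsto_measure_iInter_atTop
      (fun m => (isClosed_nearSector _ _ _ _).measurableSet.nullMeasurableSet) ?_ ⟨0, ?_⟩)
    · exact measure_ne_top_of_subset (fun x hx => (Set.mem_iInter.1 hx 0).1) hfin
    · intro m m' hm
      have hm' : (m : ℝ) ≤ m' := by exact_mod_cast hm
      exact nearSector_mono u hh k (by gcongr) (ht1 m).le
    · exact measure_ne_top_of_subset (fun x hx => hx.1) hfin
  have hle := le_of_tendsto_of_tendsto' hlim1 (hlim2.const_mul (Module.finrank ℝ E : ℝ))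
    fun m => key _ (ht0 m) (ht1 m)
  refine (le_of_mul_le_mul_left hle hd).trans (measureReal_mono (fun x hx => ?_)
    (measure_ne_top_of_subset (fun x hx => hx.1) hfin))
  rw [Set.mem_iInter] at hx
  refine ⟨(hx 0).1, fun j => ?_⟩
  have hlim3 : Filter.Tendsto (fun m : ℕ => (1 - 1 / ((m : ℝ) + 2)) * (inner ℝ x (u j) / h j))
      Filter.atTop (nhds ((1 - 0) * (inner ℝ x (u j) / h j))) :=
    (tendsto_const_nhds.sub htlim).mul tendsto_const_nhds
  rw [sub_zero, one_mul] at hlim3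
  exact le_of_tendsto' hlim3 fun m => (hx m).2.2 j

/-- The cones over the facets of a minimizer have volumes proportional to `L k * h k`: they have at
least these volumes, and both families add up to one. -/
theorem volume_truncatedCone_openFacet_eq [Fintype ι] [Nontrivial E] {u : ι → E}
    (hu1 : ∀ k, ‖u k‖ = 1) (huinj : Function.Injective u)
    (hu : ∀ v : E, v ≠ 0 → ∃ k, 0 < inner ℝ v (u k)) {L h : ι → ℝ} (hL : ∀ k, 0 < L k)
    (hh : ∀ k, 0 < h k) (hV : 1 ≤ volume (wulff u h))
    (hmin : ∀ g : ι → ℝ, 1 ≤ volume (wulff u g) → ∑ k, L k * h k ≤ ∑ k, L k * g k) (k : ι) :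
    volume (truncatedCone (openFacet u h k)) =
      ENNReal.ofReal (L k * h k / ∑ j, L j * h j) := by
  have hfin : volume (wulff u h) ≠ ⊤ := (isCompact_wulff hu h).measure_lt_top.ne
  have hS : 0 < ∑ j, L j * h j :=
    Finset.sum_pos (fun j _ => mul_pos (hL j) (hh j)) ⟨k, Finset.mem_univ k⟩
  have hconefin : ∀ j, volume (truncatedCone (openFacet u h j)) ≠ ⊤ := fun j =>
    measure_ne_top_of_subset (truncatedCone_openFacet_subset_wulff u hh j) hfin
  have hle : ∀ j, L j * h j / ∑ i, L i * h i ≤ volume.real (truncatedCone (openFacet u h j)) :=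
    fun j => (le_volume_sector hu hL hh hV hmin j).trans
      (ENNReal.toReal_mono (hconefin j) (volume_sector_le hu1 huinj hu hh j))
  have hsum1 : ∑ j, L j * h j / ∑ i, L i * h i = 1 := by
    rw [← Finset.sum_div, div_self hS.ne']
  have hV1 : volume.real (wulff u h) ≤ 1 := by
    have := volume_wulff_mul_pow_le hu hS.le hmin hS.le
    exact le_of_mul_le_mul_right (by rwa [one_mul]) (pow_pos hS (Module.finrank ℝ E))
  have hsum2 : ∑ j, volume.real (truncatedCone (openFacet u h j)) ≤ 1 := by
    refine le_trans ?_ hV1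
    have := ENNReal.toReal_mono hfin (sum_volume_truncatedCone_openFacet_le u hh)
    rwa [ENNReal.toReal_sum fun j _ => hconefin j] at this
  have heq := (Finset.sum_eq_sum_iff_of_le fun j (_ : j ∈ Finset.univ) => hle j).1
    (le_antisymm (Finset.sum_le_sum fun j _ => hle j) (hsum2.trans_eq hsum1.symm)) k
    (Finset.mem_univ k)
  rw [heq, measureReal_def, ENNReal.ofReal_toReal (hconefin k)]

open scoped Pointwise in
/-- The heights of a polytope whose facets have the prescribed `L_p` surface areas. -/
theorem exists_rpow_mul_area_openFacet_eq [Fintype ι] [Nontrivial E] {u : ι → E}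
    (hu1 : ∀ k, ‖u k‖ = 1) (huinj : Function.Injective u)
    (hu : ∀ v : E, v ≠ 0 → ∃ k, 0 < inner ℝ v (u k)) {α : ι → ℝ} (hα : ∀ k, 0 < α k) {p : ℝ}
    (hp0 : 0 < p) (hp1 : p < 1) :
    ∃ h : ι → ℝ, (∀ k, 0 < h k) ∧ ∀ k, ENNReal.ofReal (h k ^ (1 - p)) *
      Measure.euclideanHausdorffMeasure (Module.finrank ℝ E - 1) (openFacet u h k) =
        ENNReal.ofReal (α k) := by
  obtain ⟨h, hh, hV, hmin⟩ := exists_forall_sum_mul_le hu1 hu hα hp0 hp1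
  have hd1 : 1 ≤ Module.finrank ℝ E := Module.finrank_pos
  set d := Module.finrank ℝ E with hdd
  have hd : (0 : ℝ) < d := by exact_mod_cast hd1
  obtain ⟨v, hv⟩ := exists_ne (0 : E)
  obtain ⟨k₀, -⟩ := hu v hv
  have : Nonempty ι := ⟨k₀⟩
  have hterm : ∀ k, α k * h k ^ (p - 1) * h k = α k * h k ^ p := fun k => by
    rw [mul_assoc, ← Real.rpow_add_one (hh k).ne', sub_add_cancel]
  set S := powerSum α p h with hS
  have hS0 : 0 < S := powerSum_pos hα p hh
  have hvol : ∀ k, volume (truncatedCone (openFacet u h k)) =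
      ENNReal.ofReal (α k * h k ^ p / S) := by
    intro k
    rw [volume_truncatedCone_openFacet_eq hu1 huinj hu
      (fun j => mul_pos (hα j) (Real.rpow_pos_of_pos (hh j) (p - 1))) hh hV hmin k]
    simp only [hterm]
    rfl
  have harea : ∀ k, ENNReal.ofReal (h k ^ (1 - p)) *
      Measure.euclideanHausdorffMeasure (d - 1) (openFacet u h k) =
        ENNReal.ofReal (d * α k / S) := by
    intro k
    have h1 := hvol k
    rw [volume_truncatedCone (measurableSet_openFacet u h k) (hu1 k) (hh k) fun x hx => hx.1,
      ← hdd] at h1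
    have h2 : h k ^ (1 - p) = d * h k ^ (-p) * (h k / d) := by
      rw [sub_eq_neg_add, Real.rpow_add_one (hh k).ne']
      field_simp
    have hnn : 0 ≤ d * h k ^ (-p) := mul_nonneg hd.le (Real.rpow_nonneg (hh k).le _)
    rw [h2, ENNReal.ofReal_mul hnn, mul_assoc, h1, ← ENNReal.ofReal_mul hnn]
    congr 1
    rw [Real.rpow_neg (hh k).le]
    have := (Real.rpow_pos_of_pos (hh k) p).ne'
    field_simp
  -- rescaling by `c` multiplies the `L_p` surface areas by `c ^ (d - p)`
  have hdp : (0 : ℝ) < d - p := by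
    have : (1 : ℝ) ≤ d := by exact_mod_cast hd1
    linarith
  set c := (S / d) ^ ((d : ℝ) - p)⁻¹ with hc
  have hSd : 0 < S / d := div_pos hS0 hd
  have hc0 : 0 < c := Real.rpow_pos_of_pos hSd _
  refine ⟨fun k => c * h k, fun k => mul_pos hc0 (hh k), fun k => ?_⟩
  rw [openFacet_const_mul u h hc0, Measure.euclideanHausdorffMeasure_smul₀ _ hc0.ne',
    Real.mul_rpow hc0.le (hh k).le, ENNReal.ofReal_mul (Real.rpow_nonneg hc0.le _),
    ENNReal.smul_def, smul_eq_mul]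
  have hcoe : ((‖c‖₊ ^ (d - 1) : NNReal) : ℝ≥0∞) = ENNReal.ofReal (c ^ (d - 1)) := by
    rw [ENNReal.ofReal, Real.toNNReal_of_nonneg (pow_nonneg hc0.le _)]
    congr 1
    ext
    simp [abs_of_pos hc0]
  rw [hcoe, mul_mul_mul_comm, harea, ← ENNReal.ofReal_mul (Real.rpow_nonneg hc0.le _),
    ← ENNReal.ofReal_mul (by positivity)]
  congr 1
  have hpow : c ^ (1 - p) * c ^ (d - 1) = S / d := by
    rw [← Real.rpow_natCast, ← Real.rpow_add hc0, Nat.cast_sub hd1, Nat.cast_one,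
      show 1 - p + ((d : ℝ) - 1) = d - p by ring, hc, ← Real.rpow_mul hSd.le,
      inv_mul_cancel₀ hdp.ne', Real.rpow_one]
  rw [hpow]
  field_simp

end FirstVariation

/-! ### Discrete measures on the sphere -/

section Measures

variable {n : ℕ}

theorem exists_inner_pos_of_not_concentratedOnClosedHemisphere
    {A : Set (Metric.sphere (0 : EuclideanSpace ℝ (Fin n)) 1)}
    (hA : ¬ ConcentratedOnClosedHemisphere A) (v : EuclideanSpace ℝ (Fin n)) (hv : v ≠ 0) :
    ∃ a ∈ A, 0 < inner ℝ v (a : EuclideanSpace ℝ (Fin n)) := by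
  by_contra! hcon
  have hn : 0 < ‖v‖ := norm_pos_iff.2 hv
  refine hA ⟨⟨-(‖v‖⁻¹ • v), by simp [norm_smul, hn.ne']⟩, fun a ha => ?_⟩
  have h1 := hcon a ha
  rw [real_inner_comm] at h1
  simp only [closedHemisphere, Set.mem_ofPred_eq, inner_neg_right, inner_smul_right]
  have := mul_nonpos_of_nonneg_of_nonpos (inv_pos.2 hn).le h1
  linarith

theorem isClosed_closedHemisphere (v : Metric.sphere (0 : EuclideanSpace ℝ (Fin n)) 1) :
    IsClosed (closedHemisphere v) :=
  isClosed_le continuous_const (by fun_prop)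

open scoped Classical in
theorem sum_smul_dirac_apply {X : Type*} [MeasurableSpace X] (s : Finset X) (α : X → ℝ)
    {ω : Set X} (hω : MeasurableSet ω) :
    (∑ u ∈ s, ENNReal.ofReal (α u) • Measure.dirac u) ω =
      ∑ u ∈ s.filter (· ∈ ω), ENNReal.ofReal (α u) := by
  rw [Measure.finsetSum_apply, Finset.sum_filter]
  refine Finset.sum_congr rfl fun u _ => ?_
  rw [Measure.smul_apply, Measure.dirac_apply' u hω, smul_eq_mul]
  by_cases hu : u ∈ ω <;> simp [hu]

theorem support_sum_smul_dirac_subset (s : Finset (Metric.sphere (0 : EuclideanSpace ℝ (Fin n)) 1))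
    (α : Metric.sphere (0 : EuclideanSpace ℝ (Fin n)) 1 → ℝ) :
    (∑ u ∈ s, ENNReal.ofReal (α u) • Measure.dirac u).support ⊆ s := by
  refine Measure.support_subset_of_isClosed s.finite_toSet.isClosed ?_
  rw [mem_ae_iff, sum_smul_dirac_apply s α s.finite_toSet.isClosed.measurableSet.compl]
  simp

/-- Existence in the discrete `L_p` Minkowski problem, with the masses placed at the distinct points
of a finite set. -/
theorem exists_polytope_of_finset (hn : 1 ≤ n) {p : ℝ} (hp0 : 0 < p) (hp1 : p < 1)
    (s : Finset (Metric.sphere (0 : EuclideanSpace ℝ (Fin n)) 1))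
    {α : Metric.sphere (0 : EuclideanSpace ℝ (Fin n)) 1 → ℝ} (hα : ∀ u ∈ s, 0 < α u)
    (hs : ¬ ConcentratedOnClosedHemisphere
      (s : Set (Metric.sphere (0 : EuclideanSpace ℝ (Fin n)) 1))) :
    ∃ P : Set (EuclideanSpace ℝ (Fin n)), IsPolytope P ∧ 0 ∈ interior P ∧
      IsLpSurfaceAreaMeasure p P (∑ u ∈ s, ENNReal.ofReal (α u) • Measure.dirac u) := by
  classical
  have : Nonempty (Fin n) := ⟨⟨0, hn⟩⟩
  let u : s → Metric.sphere (0 : EuclideanSpace ℝ (Fin n)) 1 := Subtype.val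
  have hu : ∀ v : EuclideanSpace ℝ (Fin n), v ≠ 0 →
      ∃ k, 0 < inner ℝ v (u k : EuclideanSpace ℝ (Fin n)) := fun v hv => by
    obtain ⟨a, ha, hpos⟩ := exists_inner_pos_of_not_concentratedOnClosedHemisphere hs v hv
    exact ⟨⟨a, ha⟩, hpos⟩
  obtain ⟨h, hh, harea⟩ := exists_rpow_mul_area_openFacet_eq
    (u := fun k => (u k : EuclideanSpace ℝ (Fin n))) (fun k => by simp)
    (Subtype.val_injective.comp Subtype.val_injective) hu (α := fun k => α (u k))
    (fun k => hα _ k.2) hp0 hp1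
  rw [finrank_euclideanSpace_fin] at harea
  have h0 := zero_mem_interior_wulff (u := fun k => (u k : EuclideanSpace ℝ (Fin n))) hh
  refine ⟨wulff (fun k => (u k : EuclideanSpace ℝ (Fin n))) h,
    ⟨exists_finset_wulff_eq_convexHull hu h, ?_⟩, h0, fun ω hω => ?_⟩
  · exact Measure.measure_pos_of_nonempty_interior _ ⟨0, h0⟩
  · rw [lpSurfaceArea_wulff p Subtype.val_injective, sum_smul_dirac_apply s α hω,
      Finset.sum_congr rfl fun k _ => harea k, Finset.sum_filter, Finset.sum_filter,
      ← Finset.sum_coe_sort s]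

theorem not_concentratedOnClosedHemisphere_support {p : ℝ} {P : Set (EuclideanSpace ℝ (Fin n))}
    (hP : IsPolytope P) (h0 : 0 ∈ interior P)
    {μ : Measure (Metric.sphere (0 : EuclideanSpace ℝ (Fin n)) 1)}
    (hμ : IsLpSurfaceAreaMeasure p P μ) : ¬ ConcentratedOnClosedHemisphere μ.support := by
  rintro ⟨v, hv⟩
  refine lpSurfaceArea_ne_zero_of_isPolytope p hP h0 v ?_
  rw [← hμ _ (isClosed_closedHemisphere v).measurableSet.compl]
  exact measure_mono_null (Set.compl_subset_compl.2 hv) Measure.measure_compl_support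

end Measures

end LpMinkowski

theorem mainTheorem1 (n : ℕ) (hn : 1 ≤ n) (p : ℝ) (hp0 : 0 < p) (hp1 : p < 1) :
    (∀ μ : Measure (Metric.sphere (0 : EuclideanSpace ℝ (Fin n)) 1),
      LpMinkowski.IsDiscreteMeasure μ →
        ((∃ P : Set (EuclideanSpace ℝ (Fin n)),
            LpMinkowski.IsPolytope P ∧ 0 ∈ interior P ∧
              LpMinkowski.IsLpSurfaceAreaMeasure p P μ) ↔
          ¬ LpMinkowski.ConcentratedOnClosedHemisphere μ.support)) ∧
    (∀ (N : ℕ) (_ : n + 1 ≤ N) (u : Fin N → Metric.sphere (0 : EuclideanSpace ℝ (Fin n)) 1)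
      (α : Fin N → ℝ), (∀ k, 0 < α k) →
        ¬ LpMinkowski.ConcentratedOnClosedHemisphere (Set.range u) →
        ∃ P₀ : Set (EuclideanSpace ℝ (Fin n)),
          LpMinkowski.IsPolytope P₀ ∧ 0 ∈ interior P₀ ∧
            LpMinkowski.IsLpSurfaceAreaMeasure p P₀
              (∑ k, ENNReal.ofReal (α k) • Measure.dirac (u k))) := by
  classical
  refine ⟨fun μ hμ => ⟨?_, fun hsupp => ?_⟩, fun N _ u α hα hu => ?_⟩
  · rintro ⟨P, hP, h0, hPμ⟩
    exact LpMinkowski.not_concentratedOnClosedHemisphere_support hP h0 hPμ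
  · obtain ⟨s, α, hα, rfl⟩ := hμ
    refine LpMinkowski.exists_polytope_of_finset hn hp0 hp1 s hα fun ⟨v, hv⟩ => hsupp ⟨v, ?_⟩
    exact (LpMinkowski.support_sum_smul_dirac_subset s α).trans hv
  · -- the vectors `u k` may repeat, so the masses at each point are added up first
    have hsum : ∑ k, ENNReal.ofReal (α k) • Measure.dirac (u k) =
        ∑ x ∈ Finset.univ.image u, ENNReal.ofReal (∑ k with u k = x, α k) • Measure.dirac x := by
      rw [← Finset.sum_fiberwise_of_maps_to
        (fun k _ => Finset.mem_image_of_mem u (Finset.mem_univ k))]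
      refine Finset.sum_congr rfl fun x _ => ?_
      rw [ENNReal.ofReal_sum_of_nonneg fun k _ => (hα k).le, Finset.sum_smul]
      exact Finset.sum_congr rfl fun k hk => by rw [(Finset.mem_filter.1 hk).2]
    rw [hsum]
    refine LpMinkowski.exists_polytope_of_finset hn hp0 hp1 _
      (α := fun x => ∑ k with u k = x, α k) (fun x hx => ?_) (by simpa using hu)
    obtain ⟨k, -, hk⟩ := Finset.mem_image.1 hx
    exact Finset.sum_pos (fun k _ => hα k) ⟨k, by simp [hk]⟩
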